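/- Let $H=\left(\frac{a,b}{\mathbb{Q}}\right)$ ($a,b\in\mathbb{Q}^\times$) be a quaternion algebra over $\mathbb{Q}$, with standard involution $x\mapsto\overline{x}$ and reduced norm $\mathrm{nrm}(x)=x\overline{x}$. Let $\ddagger$ be an orthogonal involution of $H$, that is, a $\mathbb{Q}$-linear map $H\to H$ with $(xy)^\ddagger=y^\ddagger x^\ddagger$ and $(x^\ddagger)^\ddagger=x$ whose fixed space $H^+=\{h\in H : h^\ddagger=h\}$ is three-dimensional. For a commutative $\mathbb{Q}$-algebra $R$, write $H_R=R\otimes_{\mathbb{Q}}H$, extend $\ddagger$ to $H_R$ by $R$-linearity, and put $$SL^\ddagger(2,H)(R)=\left\{\begin{pmatrix} \alpha & \beta\\ \gamma & \delta\end{pmatrix}\in \mathrm{Mat}(2,H_R) : (\alpha\beta^\ddagger)^\ddagger=\alpha\beta^\ddagger,\ (\gamma\delta^\ddagger)^\ddagger=\gamma\delta^\ddagger,\ \alpha\delta^\ddagger-\beta\gamma^\ddagger=1\right\},$$ a group under matrix multiplication. Let $q_H$ be the quadratic form on $\mathbb{Q}^2\times H^+$ given by $q_H(\kappa,\kappa',\xi)=-\kappa\kappa'+\mathrm{nrm}(\xi)$,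 and let $\mathrm{Spin}(q_H)$ be its spin group: writing $V=\mathbb{Q}^2\times H^+$, the group $\mathrm{Spin}(q_H)(R)$ consists of the units $x$ of $R\otimes_{\mathbb{Q}}\mathrm{Cl}(q_H)$ that lie in the even part $R\otimes_{\mathbb{Q}}\mathrm{Cl}^0(q_H)$ and satisfy $x\,(R\otimes V)\,x^{-1}=R\otimes V$ and $x\,\tilde{x}=1$, where $x\mapsto\tilde{x}$ is the canonical anti-automorphism fixing the vectors. Then $SL^\ddagger(2,H)$ and $\mathrm{Spin}(q_H)$, as functors from commutative $\mathbb{Q}$-algebras to groups, are affine algebraic groups over $\mathbb{Q}$ (each is represented by a finitely generated commutative $\mathbb{Q}$-algebra), and they are isomorphic as algebraic groups over $\mathbb{Q}$. -/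

import Mathlib

open scoped TensorProduct Quaternion
open CategoryTheory

noncomputable section

/-! ### Affine algebraic groups over `ℚ` through their functors of points -/

/-- A group-valued functor on commutative `ℚ`-algebras is an affine algebraic group over `ℚ` if it
is represented by a finitely generated commutative `ℚ`-algebra. By the Yoneda lemma, isomorphisms
of affine algebraic groups are the same as isomorphisms of such functors. -/
def IsAffineAlgebraicGroup (G : CommAlgCat.{0} ℚ ⥤ GrpCat.{0}) : Prop :=
  ∃ A : CommAlgCat.{0} ℚ, Algebra.FiniteType ℚ A ∧
    Nonempty ((G ⋙ forget GrpCat.{0}).CorepresentableBy A)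

/-! ### Involutions of the first kind on a `ℚ`-algebra -/

/-- A `ℚ`-linear anti-automorphism of `H` whose square is the identity. -/
structure AlgInvolution (H : Type) [Ring H] [Algebra ℚ H] extends H →ₗ[ℚ] H where
  map_mul_rev' : ∀ x y : H, toFun (x * y) = toFun y * toFun x
  involutive' : ∀ x : H, toFun (toFun x) = x

namespace AlgInvolution

variable {H : Type} [Ring H] [Algebra ℚ H] (τ : AlgInvolution H)

/-- The subspace `H⁺` of elements fixed by the involution. -/
def plus : Submodule ℚ H := LinearMap.eqLocus τ.toLinearMap LinearMap.id

theorem mem_plus {x : H} : x ∈ τ.plus ↔ τ.toLinearMap x = x := Iff.rfl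

/-- The `R`-linear extension of the involution to `H_R = R ⊗ H`. -/
def baseExt (R : Type) [CommRing R] [Algebra ℚ R] : R ⊗[ℚ] H →ₗ[R] R ⊗[ℚ] H :=
  τ.toLinearMap.baseChange R

section

variable (R : Type) [CommRing R] [Algebra ℚ R]

theorem baseExt_mul (x y : R ⊗[ℚ] H) : τ.baseExt R (x * y) = τ.baseExt R y * τ.baseExt R x := by
  induction x using TensorProduct.induction_on with
  | zero => simp
  | add x₁ x₂ h₁ h₂ => simp only [add_mul, mul_add, map_add, h₁, h₂]
  | tmul r h =>
    induction y using TensorProduct.induction_on with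
    | zero => simp
    | add y₁ y₂ h₁ h₂ => simp only [add_mul, mul_add, map_add, h₁, h₂]
    | tmul s k =>
      have := τ.map_mul_rev' h k
      simp only [baseExt, Algebra.TensorProduct.tmul_mul_tmul, LinearMap.baseChange_tmul]
      rw [mul_comm r s]
      exact congrArg _ this

theorem baseExt_baseExt (x : R ⊗[ℚ] H) : τ.baseExt R (τ.baseExt R x) = x := by
  induction x using TensorProduct.induction_on with
  | zero => simp
  | add x₁ x₂ h₁ h₂ => simp only [map_add, h₁, h₂]
  | tmul r h =>
    simp only [baseExt, LinearMap.baseChange_tmul]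
    exact congrArg _ (τ.involutive' h)

theorem baseExt_one : τ.baseExt R 1 = 1 := by
  have h := τ.baseExt_mul R (τ.baseExt R 1) 1
  rw [mul_one, baseExt_baseExt, mul_one] at h
  exact h.symm

theorem baseExt_map {R S : Type} [CommRing R] [Algebra ℚ R] [CommRing S] [Algebra ℚ S]
    (f : R →ₐ[ℚ] S) (x : R ⊗[ℚ] H) :
    τ.baseExt S (Algebra.TensorProduct.map f (AlgHom.id ℚ H) x) =
      Algebra.TensorProduct.map f (AlgHom.id ℚ H) (τ.baseExt R x) := by
  induction x using TensorProduct.induction_on with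
  | zero => simp
  | add x₁ x₂ h₁ h₂ => simp only [map_add, h₁, h₂]
  | tmul r h => simp [baseExt]

/-! ### The group `SL‡(2, H)` -/

/-- The matrix `(d‡, -b‡; -c‡, a‡)` attached to `(a, b; c, d)`. -/
def adj (M : Matrix (Fin 2) (Fin 2) (R ⊗[ℚ] H)) : Matrix (Fin 2) (Fin 2) (R ⊗[ℚ] H) :=
  !![τ.baseExt R (M 1 1), -τ.baseExt R (M 0 1); -τ.baseExt R (M 1 0), τ.baseExt R (M 0 0)]

/-- The conditions `ab‡ ∈ H⁺`, `cd‡ ∈ H⁺` and `ad‡ - bc‡ = 1` on a matrix `(a, b; c, d)` over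
`H_R = R ⊗ H`. -/
def IsSL (M : Matrix (Fin 2) (Fin 2) (R ⊗[ℚ] H)) : Prop :=
  τ.baseExt R (M 0 0 * τ.baseExt R (M 0 1)) = M 0 0 * τ.baseExt R (M 0 1) ∧
  τ.baseExt R (M 1 0 * τ.baseExt R (M 1 1)) = M 1 0 * τ.baseExt R (M 1 1) ∧
  M 0 0 * τ.baseExt R (M 1 1) - M 0 1 * τ.baseExt R (M 1 0) = 1

theorem adj_adj (M : Matrix (Fin 2) (Fin 2) (R ⊗[ℚ] H)) : τ.adj R (τ.adj R M) = M := by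
  ext i j
  fin_cases i <;> fin_cases j <;> simp [adj, baseExt_baseExt]

theorem adj_one : τ.adj R 1 = 1 := by
  ext i j
  fin_cases i <;> fin_cases j <;> simp [adj, baseExt_one]

theorem adj_mul (M N : Matrix (Fin 2) (Fin 2) (R ⊗[ℚ] H)) :
    τ.adj R (M * N) = τ.adj R N * τ.adj R M := by
  ext i j
  fin_cases i <;> fin_cases j <;>
    simp [adj, Matrix.mul_apply, Fin.sum_univ_two, baseExt_mul] <;> abel

theorem isSL_iff (M : Matrix (Fin 2) (Fin 2) (R ⊗[ℚ] H)) : τ.IsSL R M ↔ M * τ.adj R M = 1 := by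
  rw [← Matrix.ext_iff]
  simp only [IsSL, adj, Fin.forall_fin_two, Matrix.mul_apply, Fin.sum_univ_two, Matrix.of_apply,
    Matrix.cons_val_zero, Matrix.cons_val_one, Matrix.cons_val', Matrix.cons_val_fin_one,
    Matrix.one_apply, baseExt_mul, baseExt_baseExt, mul_neg]
  norm_num
  constructor
  · rintro ⟨h₁, h₂, h₃⟩
    have h₄ := congrArg (τ.baseExt R) h₃
    simp only [map_sub, baseExt_mul, baseExt_baseExt, baseExt_one] at h₄
    refine ⟨⟨by rw [← sub_eq_add_neg]; exact h₃, by rw [h₁]; abel⟩, by rw [h₂]; abel, ?_⟩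
    rw [← h₄]; abel
  · rintro ⟨⟨h₁, h₂⟩, h₃, -⟩
    refine ⟨?_, ?_, by rw [sub_eq_add_neg]; exact h₁⟩
    · rw [← sub_eq_zero, ← h₂]; abel
    · rw [← sub_eq_zero, ← neg_eq_zero, ← h₃]; abel

/-- `SL‡(2, H_R)` as a submonoid of the `2 × 2` matrices over `H_R`. -/
def slMonoid : Submonoid (Matrix (Fin 2) (Fin 2) (R ⊗[ℚ] H)) where
  carrier := {M | τ.IsSL R M}
  one_mem' := by
    rw [Set.mem_ofPred_eq, isSL_iff, adj_one, mul_one]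
  mul_mem' := by
    intro M N hM hN
    rw [Set.mem_ofPred_eq, isSL_iff] at *
    rw [adj_mul, mul_assoc, ← mul_assoc N, hN, one_mul, hM]

variable {R} in
/-- Over a finite-dimensional algebra, matrices satisfying the conditions are invertible. -/
theorem adj_mul_self [Module.Finite ℚ H] {M : Matrix (Fin 2) (Fin 2) (R ⊗[ℚ] H)}
    (h : τ.IsSL R M) : τ.adj R M * M = 1 := by
  rw [isSL_iff] at h
  have hs : Function.Surjective (LinearMap.mulLeft R M) := fun z =>
    ⟨τ.adj R M * z, by rw [LinearMap.mulLeft_apply, ← mul_assoc, h, one_mul]⟩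
  apply OrzechProperty.injective_of_surjective_endomorphism _ hs
  rw [LinearMap.mulLeft_apply, LinearMap.mulLeft_apply, ← mul_assoc, h, one_mul, mul_one]

instance slGroup [Module.Finite ℚ H] : Group (τ.slMonoid R) where
  inv M := ⟨τ.adj R M.1, by
    change τ.IsSL R _
    rw [isSL_iff, adj_adj]
    exact τ.adj_mul_self M.2⟩
  inv_mul_cancel M := Subtype.ext (τ.adj_mul_self M.2)

end

/-- Functoriality of `SL‡(2, H_R)` in `R`, entry by entry. -/
def slMap {R S : Type} [CommRing R] [Algebra ℚ R] [CommRing S] [Algebra ℚ S]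
    (f : R →ₐ[ℚ] S) : τ.slMonoid R →* τ.slMonoid S where
  toFun M := ⟨M.1.map (Algebra.TensorProduct.map f (AlgHom.id ℚ H)), by
    obtain ⟨h₁, h₂, h₃⟩ := M.2
    refine ⟨?_, ?_, ?_⟩ <;> simp only [Matrix.map_apply, baseExt_map, ← map_mul, ← map_sub]
    · rw [h₁]
    · rw [h₂]
    · rw [h₃, map_one]⟩
  map_one' := Subtype.ext (Matrix.map_one _ (map_zero _) (map_one _))
  map_mul' M N := Subtype.ext Matrix.map_mul

/-- The group `SL‡(2, H)` over `ℚ`, as the functor `R ↦ SL‡(2, R ⊗ H)`. -/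
def SL [Module.Finite ℚ H] : CommAlgCat.{0} ℚ ⥤ GrpCat.{0} where
  obj R := GrpCat.of (τ.slMonoid R)
  map f := GrpCat.ofHom (τ.slMap f.hom)
  map_id R := by
    refine GrpCat.hom_ext (MonoidHom.ext fun M => Subtype.ext ?_)
    change M.1.map (Algebra.TensorProduct.map (AlgHom.id ℚ R) (AlgHom.id ℚ H)) = M.1
    rw [Algebra.TensorProduct.map_id]
    rfl
  map_comp {R S T} f g := by
    refine GrpCat.hom_ext (MonoidHom.ext fun M => Subtype.ext ?_)
    change M.1.map (Algebra.TensorProduct.map (g.hom.comp f.hom) (AlgHom.id ℚ H)) =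
      (M.1.map (Algebra.TensorProduct.map f.hom (AlgHom.id ℚ H))).map
        (Algebra.TensorProduct.map g.hom (AlgHom.id ℚ H))
    rw [Matrix.map_map]
    congr 1
    rw [← AlgHom.coe_comp, ← Algebra.TensorProduct.map_comp, AlgHom.comp_id]

end AlgInvolution

/-! ### The spin group of a quadratic form -/

section Spin

variable {V : Type} [AddCommGroup V] [Module ℚ V] (Q : QuadraticForm ℚ V)

/-- The image of `R ⊗ V` in `R ⊗ Cl(Q)`, the Clifford algebra of the form `Q` over `R`. -/
def spinVectors (R : Type) [CommRing R] [Algebra ℚ R] :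
    Submodule R (R ⊗[ℚ] CliffordAlgebra Q) :=
  LinearMap.range ((CliffordAlgebra.ι Q).baseChange R)

/-- The image of `R ⊗ Cl⁰(Q)` in `R ⊗ Cl(Q)`. -/
def spinEven (R : Type) [CommRing R] [Algebra ℚ R] :
    Subalgebra ℚ (R ⊗[ℚ] CliffordAlgebra Q) :=
  (Algebra.TensorProduct.map (AlgHom.id ℚ R) (CliffordAlgebra.even Q).val).range

/-- The canonical anti-automorphism of `R ⊗ Cl(Q)` that fixes the vectors. -/
def spinRev (R : Type) [CommRing R] [Algebra ℚ R] :
    R ⊗[ℚ] CliffordAlgebra Q →ₗ[R] R ⊗[ℚ] CliffordAlgebra Q :=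
  (CliffordAlgebra.reverse (Q := Q)).baseChange R

theorem spinRev_mul (R : Type) [CommRing R] [Algebra ℚ R] (x y : R ⊗[ℚ] CliffordAlgebra Q) :
    spinRev Q R (x * y) = spinRev Q R y * spinRev Q R x := by
  induction x using TensorProduct.induction_on with
  | zero => simp
  | add x₁ x₂ h₁ h₂ => simp only [add_mul, mul_add, map_add, h₁, h₂]
  | tmul r h =>
    induction y using TensorProduct.induction_on with
    | zero => simp
    | add y₁ y₂ h₁ h₂ => simp only [add_mul, mul_add, map_add, h₁, h₂]
    | tmul s k =>
      simp only [spinRev, Algebra.TensorProduct.tmul_mul_tmul, LinearMap.baseChange_tmul,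
        CliffordAlgebra.reverse.map_mul]
      rw [mul_comm r s]

theorem spinRev_one (R : Type) [CommRing R] [Algebra ℚ R] : spinRev Q R 1 = 1 := by
  simp [spinRev, Algebra.TensorProduct.one_def]

theorem spinRev_mem_even (R : Type) [CommRing R] [Algebra ℚ R] {x : R ⊗[ℚ] CliffordAlgebra Q}
    (hx : x ∈ spinEven Q R) : spinRev Q R x ∈ spinEven Q R := by
  obtain ⟨y, rfl⟩ := hx
  induction y using TensorProduct.induction_on with
  | zero => simp [zero_mem]
  | add y₁ y₂ h₁ h₂ => simpa only [map_add] using add_mem h₁ h₂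
  | tmul r c =>
    refine ⟨r ⊗ₜ ⟨CliffordAlgebra.reverse c.1, ?_⟩, ?_⟩
    · exact (CliffordAlgebra.reverse_mem_evenOdd_iff (Q := Q) (n := 0)).2 c.2
    · simp [spinRev]

/-- The points of `Spin(Q)` over `R`: the even units `x` of `R ⊗ Cl(Q)` with `x (R ⊗ V) x⁻¹ = R ⊗ V`
and with spinor norm `x · rev x = 1`. -/
def spinPoints (R : Type) [CommRing R] [Algebra ℚ R] :
    Subgroup (R ⊗[ℚ] CliffordAlgebra Q)ˣ where
  carrier := {x | (x : R ⊗[ℚ] CliffordAlgebra Q) ∈ spinEven Q R ∧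
    (x : R ⊗[ℚ] CliffordAlgebra Q) * spinRev Q R x = 1 ∧
    ∀ v : R ⊗[ℚ] CliffordAlgebra Q,
      v ∈ spinVectors Q R ↔ (x : R ⊗[ℚ] CliffordAlgebra Q) * v * ↑(x⁻¹) ∈ spinVectors Q R}
  one_mem' := ⟨one_mem _, by simp [spinRev_one], by simp⟩
  mul_mem' := by
    rintro x y ⟨hx₁, hx₂, hx₃⟩ ⟨hy₁, hy₂, hy₃⟩
    refine ⟨mul_mem hx₁ hy₁, ?_, fun v => ?_⟩
    · rw [Units.val_mul, spinRev_mul, mul_assoc, ← mul_assoc (y : R ⊗[ℚ] CliffordAlgebra Q), hy₂,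
        one_mul, hx₂]
    · rw [hy₃, hx₃]
      simp only [mul_inv_rev, Units.val_mul, mul_assoc]
  inv_mem' := by
    rintro x ⟨hx₁, hx₂, hx₃⟩
    have hinv : (↑(x⁻¹) : R ⊗[ℚ] CliffordAlgebra Q) = spinRev Q R x := by
      rw [← x.inv_mul_cancel_left (spinRev Q R x), hx₂, mul_one]
    refine ⟨?_, ?_, fun v => ?_⟩
    · rw [hinv]; exact spinRev_mem_even Q R hx₁
    · have h := congrArg (spinRev Q R) x.inv_mul
      rw [spinRev_mul, spinRev_one, ← hinv] at h
      have h' := congrArg (fun z => (x : R ⊗[ℚ] CliffordAlgebra Q) * z) h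
      simp only [mul_one, Units.mul_inv_cancel_left] at h'
      rw [h', Units.inv_mul]
    · rw [hx₃ (↑(x⁻¹) * v * ↑(x⁻¹)⁻¹)]
      simp [mul_assoc]

variable {Q} in
theorem spin_map_mem {R S : Type} [CommRing R] [Algebra ℚ R] [CommRing S] [Algebra ℚ S]
    (f : R →ₐ[ℚ] S) {x : (R ⊗[ℚ] CliffordAlgebra Q)ˣ} (hx : x ∈ spinPoints Q R)
    {v : S ⊗[ℚ] CliffordAlgebra Q} (hv : v ∈ spinVectors Q S) :
    Algebra.TensorProduct.map f (AlgHom.id ℚ (CliffordAlgebra Q)) x * v *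
      Algebra.TensorProduct.map f (AlgHom.id ℚ (CliffordAlgebra Q)) ↑(x⁻¹) ∈ spinVectors Q S := by
  set F := Algebra.TensorProduct.map f (AlgHom.id ℚ (CliffordAlgebra Q)) with hF
  have hvec : ∀ w ∈ spinVectors Q R, F w ∈ spinVectors Q S := by
    rintro _ ⟨w, rfl⟩
    induction w using TensorProduct.induction_on with
    | zero => simp [zero_mem]
    | add w₁ w₂ h₁ h₂ => simpa only [map_add] using add_mem h₁ h₂
    | tmul r w => exact ⟨f r ⊗ₜ w, by simp [hF]⟩
  obtain ⟨w, rfl⟩ := hv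
  induction w using TensorProduct.induction_on with
  | zero => simp [zero_mem]
  | add w₁ w₂ h₁ h₂ => simpa only [map_add, mul_add, add_mul] using add_mem h₁ h₂
  | tmul s w =>
    have h₁ : (1 : R) ⊗ₜ[ℚ] CliffordAlgebra.ι Q w ∈ spinVectors Q R := ⟨1 ⊗ₜ w, by simp⟩
    have h₂ := Submodule.smul_mem _ s (hvec _ ((hx.2.2 _).1 h₁))
    rw [map_mul, map_mul] at h₂
    have h₃ : (CliffordAlgebra.ι Q).baseChange S (s ⊗ₜ w) =
        s • F ((1 : R) ⊗ₜ[ℚ] CliffordAlgebra.ι Q w) := by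
      simp [hF, TensorProduct.smul_tmul']
    rw [h₃, mul_smul_comm, smul_mul_assoc]
    exact h₂

/-- Functoriality of the points of `Spin(Q)`. -/
def spinMap {R S : Type} [CommRing R] [Algebra ℚ R] [CommRing S] [Algebra ℚ S]
    (f : R →ₐ[ℚ] S) : spinPoints Q R →* spinPoints Q S :=
  ((Units.map (Algebra.TensorProduct.map f (AlgHom.id ℚ (CliffordAlgebra Q)) :
      R ⊗[ℚ] CliffordAlgebra Q →* S ⊗[ℚ] CliffordAlgebra Q)).comp
    (spinPoints Q R).subtype).codRestrict (spinPoints Q S) (by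
      rintro ⟨x, hx⟩
      refine ⟨?_, ?_, fun v => ⟨fun hv => spin_map_mem f hx hv, fun hv => ?_⟩⟩
      · obtain ⟨y, hy⟩ := hx.1
        refine ⟨Algebra.TensorProduct.map f (AlgHom.id ℚ _) y, ?_⟩
        change _ = Algebra.TensorProduct.map f (AlgHom.id ℚ (CliffordAlgebra Q)) x.1
        rw [← hy]
        clear hy
        induction y using TensorProduct.induction_on with
        | zero => simp
        | add y₁ y₂ h₁ h₂ => simpa only [map_add] using congrArg₂ (· + ·) h₁ h₂
        | tmul r c => simp
      · have hrev : ∀ z : R ⊗[ℚ] CliffordAlgebra Q,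
            spinRev Q S (Algebra.TensorProduct.map f (AlgHom.id ℚ (CliffordAlgebra Q)) z) =
              Algebra.TensorProduct.map f (AlgHom.id ℚ (CliffordAlgebra Q)) (spinRev Q R z) := by
          intro z
          induction z using TensorProduct.induction_on with
          | zero => simp
          | add z₁ z₂ h₁ h₂ => simp only [map_add, h₁, h₂]
          | tmul r h => simp [spinRev]
        change Algebra.TensorProduct.map f (AlgHom.id ℚ (CliffordAlgebra Q)) x.1 *
          spinRev Q S (Algebra.TensorProduct.map f (AlgHom.id ℚ (CliffordAlgebra Q)) x.1) = 1
        rw [hrev, ← map_mul, hx.2.1, map_one]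
      · have h := spin_map_mem f (inv_mem hx) hv
        have e₁ : Algebra.TensorProduct.map f (AlgHom.id ℚ (CliffordAlgebra Q)) ↑(x⁻¹) *
            Algebra.TensorProduct.map f (AlgHom.id ℚ (CliffordAlgebra Q)) x.1 = 1 := by
          rw [← map_mul, Units.inv_mul, map_one]
        change Algebra.TensorProduct.map f (AlgHom.id ℚ (CliffordAlgebra Q)) ↑(x⁻¹) *
          (Algebra.TensorProduct.map f (AlgHom.id ℚ (CliffordAlgebra Q)) x.1 * v *
            Algebra.TensorProduct.map f (AlgHom.id ℚ (CliffordAlgebra Q)) ↑(x⁻¹)) *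
          Algebra.TensorProduct.map f (AlgHom.id ℚ (CliffordAlgebra Q)) ↑(x⁻¹⁻¹) ∈ _ at h
        rw [inv_inv, mul_assoc, mul_assoc _ _ (Algebra.TensorProduct.map f _ x.1), e₁, mul_one,
          ← mul_assoc, e₁, one_mul] at h
        exact h)

/-- The spin group of `Q` over `ℚ`, as a functor on commutative `ℚ`-algebras. -/
def spinFunctor : CommAlgCat.{0} ℚ ⥤ GrpCat.{0} where
  obj R := GrpCat.of (spinPoints Q R)
  map f := GrpCat.ofHom (spinMap Q f.hom)
  map_id R := by
    refine GrpCat.hom_ext (MonoidHom.ext fun x => Subtype.ext (Units.ext ?_))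
    change Algebra.TensorProduct.map (AlgHom.id ℚ R) (AlgHom.id ℚ (CliffordAlgebra Q)) x.1.1 =
      x.1.1
    rw [Algebra.TensorProduct.map_id]
    rfl
  map_comp {R S T} f g := by
    refine GrpCat.hom_ext (MonoidHom.ext fun x => Subtype.ext (Units.ext ?_))
    change Algebra.TensorProduct.map (g.hom.comp f.hom) (AlgHom.id ℚ (CliffordAlgebra Q)) x.1.1 =
      Algebra.TensorProduct.map g.hom (AlgHom.id ℚ (CliffordAlgebra Q))
        (Algebra.TensorProduct.map f.hom (AlgHom.id ℚ (CliffordAlgebra Q)) x.1.1)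
    rw [← AlgHom.comp_apply, ← Algebra.TensorProduct.map_comp, AlgHom.comp_id]

end Spin

/-! ### Rational quaternion algebras -/

section QuaternionAlg

variable {a b : ℚ}

/-- An involution of a quaternion algebra is orthogonal if its fixed space is three-dimensional. -/
def AlgInvolution.IsOrthogonal (τ : AlgInvolution ℍ[ℚ,a,b]) : Prop :=
  Module.finrank ℚ τ.plus = 3

/-- The reduced norm `nrm x = x x̄` as a quadratic form. -/
def nrm (a b : ℚ) : QuadraticForm ℚ ℍ[ℚ,a,b] :=
  LinearMap.BilinMap.toQuadraticMap
    (LinearMap.mk₂ ℚ (fun x y : ℍ[ℚ,a,b] => (x * star y).re)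
      (by intros; simp; ring) (by intros; simp)
      (by intros; simp; ring) (by intros; simp))

theorem nrm_spec (x : ℍ[ℚ,a,b]) : algebraMap ℚ ℍ[ℚ,a,b] (nrm a b x) = x * star x := by
  ext <;> simp [nrm, QuaternionAlgebra.algebraMap_eq] <;> ring

/-- The form `q(κ, κ', ξ) = -κκ' + nrm ξ` on `ℚ² × H⁺`. -/
def inversiveForm (τ : AlgInvolution ℍ[ℚ,a,b]) : QuadraticForm ℚ ((ℚ × ℚ) × τ.plus) :=
  QuadraticMap.prod (-QuadraticMap.linMulLin (LinearMap.fst ℚ ℚ ℚ) (LinearMap.snd ℚ ℚ ℚ))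
    ((nrm a b).comp τ.plus.subtype)

theorem inversiveForm_apply (τ : AlgInvolution ℍ[ℚ,a,b]) (κ κ' : ℚ) (ξ : τ.plus) :
    inversiveForm τ ((κ, κ'), ξ) = -(κ * κ') + nrm a b (ξ : ℍ[ℚ,a,b]) := rfl

end QuaternionAlg

end

/-! An orthogonal involution has the form `x ↦ m x̄ m⁻¹` with `m` pure and `m² = μ ∈ ℚˣ`
(`exists_isTwist`). A vector `(κ, κ', ξ)` can then be written as a `2 × 2` matrix over `H` whose
square is `μ · q_H` (`vectorMatrix_mul_self`). Adjoining a central `ε` with `ε² = μ⁻¹` and sending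
`v` to `ε` times its matrix gives `Cl(q_H) ≅ Mat(2, H) ⊗ ℚ[ε]`: the map is onto, and both sides have
dimension `2⁵ = 32` (`entries_bijective`). So the even part is `Mat(2, H)`, and reversal acts on it
as the anti-automorphism `(a, b; c, d) ↦ (d‡, -b‡; -c‡, a‡)`, written `adj`.

The conditions defining `SL‡(2, H)` say exactly that `M · adj M = 1` (`isSL_iff`), which under this
identification is `x · x̃ = 1`. The remaining condition `x V x⁻¹ = V` is automatic because `dim V =
5`: the odd elements fixed by reversal are the vectors and the multiples of the central volume
element, and a trace form separates the two. Conjugation by `x` with `x x̃ = 1` respects parity,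
reversal and trace (`cliffordPointHom_conj_mem_spinVectors`).

All of these are linear data over `ℚ` (`exists_even_splitting`), and every `R` is flat over `ℚ`, so
they pass to `R`-points naturally in `R`. Representability is proved for `SL‡` by equations on a
generic matrix and transported to `Spin` along the isomorphism. -/

noncomputable section

/-! ### Orthogonal involutions of a quaternion algebra are twists of conjugation. -/

section QuaternionInvolution

variable {a b : ℚ}

/-- The involution `τ` is `x ↦ m x̄ m⁻¹` for a pure quaternion `m` with `m² = μ ≠ 0`. -/
structure AlgInvolution.IsTwist (τ : AlgInvolution ℍ[ℚ,a,b]) (m : ℍ[ℚ,a,b]) (μ : ℚ) : Prop where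
  ne_zero : μ ≠ 0
  mul_self : m * m = algebraMap ℚ _ μ
  star_eq : star m = -m
  apply_eq : ∀ x, μ • τ.toLinearMap x = m * star x * m

theorem AlgInvolution.toLinearMap_mul {H : Type} [Ring H] [Algebra ℚ H] (τ : AlgInvolution H)
    (x y : H) : τ.toLinearMap (x * y) = τ.toLinearMap y * τ.toLinearMap x :=
  τ.map_mul_rev' x y

theorem AlgInvolution.toLinearMap_toLinearMap {H : Type} [Ring H] [Algebra ℚ H]
    (τ : AlgInvolution H) (x : H) : τ.toLinearMap (τ.toLinearMap x) = x :=
  τ.involutive' x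

theorem AlgInvolution.toLinearMap_one {H : Type} [Ring H] [Algebra ℚ H] (τ : AlgInvolution H) :
    τ.toLinearMap 1 = 1 := by
  have h := τ.toLinearMap_mul (τ.toLinearMap 1) 1
  rw [mul_one, toLinearMap_toLinearMap, mul_one] at h
  exact h.symm

theorem AlgInvolution.toLinearMap_algebraMap {H : Type} [Ring H] [Algebra ℚ H]
    (τ : AlgInvolution H) (r : ℚ) : τ.toLinearMap (algebraMap ℚ H r) = algebraMap ℚ H r := by
  rw [Algebra.algebraMap_eq_smul_one, map_smul, toLinearMap_one]

/-- A quaternion whose square is rational is rational or pure. -/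
theorem QuaternionAlgebra.re_eq_zero_or_eq_algebraMap {y : ℍ[ℚ,a,b]} {r : ℚ}
    (h : y * y = algebraMap ℚ _ r) : y.re = 0 ∨ y = algebraMap ℚ _ y.re := by
  by_cases h0 : y.re = 0
  · exact Or.inl h0
  right
  have h1 := congrArg QuaternionAlgebra.imI h
  have h2 := congrArg QuaternionAlgebra.imJ h
  have h3 := congrArg QuaternionAlgebra.imK h
  simp [QuaternionAlgebra.algebraMap_eq] at h1 h2 h3
  have g1 : y.re * y.imI = 0 := by linarith
  have g2 : y.re * y.imJ = 0 := by linarith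
  have g3 : y.re * y.imK = 0 := by linarith
  simp [h0] at g1 g2 g3
  ext <;> simp [QuaternionAlgebra.algebraMap_eq, g1, g2, g3]

theorem QuaternionAlgebra.mul_self_of_re_eq_zero {x : ℍ[ℚ,a,b]} (h : x.re = 0) :
    x * x = algebraMap ℚ _ (x * x).re := by
  ext <;> simp [QuaternionAlgebra.algebraMap_eq, h] <;> ring

theorem QuaternionAlgebra.star_eq_neg_of_re_eq_zero {x : ℍ[ℚ,a,b]} (h : x.re = 0) :
    star x = -x := by
  ext <;> simp [h]

/-- A pure element has rational square, hence so does its image, which is therefore pure or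
rational. In the rational case applying `τ` again shows that the element equals its image, so its
real part is zero either way. -/
theorem AlgInvolution.re_toLinearMap (τ : AlgInvolution ℍ[ℚ,a,b]) (x : ℍ[ℚ,a,b]) :
    (τ.toLinearMap x).re = x.re := by
  have key : ∀ y : ℍ[ℚ,a,b], y.re = 0 → (τ.toLinearMap y).re = 0 := by
    intro y hy
    have h1 : τ.toLinearMap y * τ.toLinearMap y = algebraMap ℚ _ (y * y).re := by
      rw [← τ.toLinearMap_mul, QuaternionAlgebra.mul_self_of_re_eq_zero hy,
        τ.toLinearMap_algebraMap]
      simp [QuaternionAlgebra.algebraMap_eq]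
    rcases QuaternionAlgebra.re_eq_zero_or_eq_algebraMap h1 with h | h
    · exact h
    · have h2 := congrArg τ.toLinearMap h
      rw [τ.toLinearMap_algebraMap, τ.toLinearMap_toLinearMap] at h2
      rw [h2] at hy
      simpa [QuaternionAlgebra.algebraMap_eq] using hy
  have h := key (x - algebraMap ℚ _ x.re) (by simp [QuaternionAlgebra.algebraMap_eq])
  rw [map_sub, τ.toLinearMap_algebraMap] at h
  simpa [QuaternionAlgebra.algebraMap_eq, sub_eq_zero] using h

theorem AlgInvolution.exists_isTwist (ha : a ≠ 0) (hb : b ≠ 0) (τ : AlgInvolution ℍ[ℚ,a,b])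
    (hτ : τ.IsOrthogonal) : ∃ m μ, τ.IsTwist m μ := by
  have hne : ∃ y, τ.toLinearMap y ≠ y := by
    by_contra! h
    have htop : τ.plus = ⊤ := by
      ext y; simp [τ.mem_plus, h y]
    have h3 := hτ
    rw [AlgInvolution.IsOrthogonal, htop, finrank_top, QuaternionAlgebra.finrank_eq_four] at h3
    omega
  obtain ⟨y, hy⟩ := hne
  obtain ⟨m, hm0, hm⟩ : ∃ m, m ≠ 0 ∧ τ.toLinearMap m = -m :=
    ⟨y - τ.toLinearMap y, sub_ne_zero.2 hy.symm, by simp [τ.toLinearMap_toLinearMap]⟩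
  have hmre : m.re = 0 := by
    have := τ.re_toLinearMap m
    rw [hm, QuaternionAlgebra.re_neg] at this
    linarith
  have hstar := QuaternionAlgebra.star_eq_neg_of_re_eq_zero hmre
  -- `m` anticommutes with the pure fixed elements
  have hcomm : ∀ x ∈ τ.plus, m * star x = x * m := by
    intro x hx
    rw [τ.mem_plus] at hx
    have e : m * star x - x * m = algebraMap ℚ _ (m * star x - x * m).re := by
      ext <;> simp [QuaternionAlgebra.algebraMap_eq, hmre] <;> ring
    have hsx : star x = algebraMap ℚ _ (2 * x.re) - x := by
      ext <;> simp [QuaternionAlgebra.algebraMap_eq]; ring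
    have hτs : τ.toLinearMap (star x) = star x := by
      rw [hsx, map_sub, τ.toLinearMap_algebraMap, hx]
    -- `τ` fixes the scalar `m x̄ - x m`, but computing term by term it also negates it; hence the
    -- scalar is zero.
    have e2 := congrArg τ.toLinearMap e
    rw [τ.toLinearMap_algebraMap, ← e, map_sub, τ.toLinearMap_mul, τ.toLinearMap_mul, hτs, hm,
      hx, hsx] at e2
    rw [← sub_eq_zero, hsx]
    have c := (Algebra.commutes (2 * x.re) m)
    have e3 : (2 : ℚ) • (m * (algebraMap ℚ ℍ[ℚ,a,b] (2 * x.re) - x) - x * m) = 0 := by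
      rw [two_smul]
      nth_rewrite 1 [← e2]
      rw [mul_sub, ← c]
      noncomm_ring
    exact (smul_eq_zero.1 e3).resolve_left two_ne_zero
  -- every element is the sum of a fixed one and a multiple of `m`
  have hspan : ∀ x, ∃ p ∈ τ.plus, ∃ c : ℚ, x = p + c • m := by
    have hmn : m ∉ τ.plus := by
      intro h
      rw [τ.mem_plus, hm] at h
      apply hm0
      have : (2 : ℚ) • m = 0 := by rw [two_smul]; nth_rewrite 1 [← h]; simp
      exact (smul_eq_zero.1 this).resolve_left two_ne_zero
    have hsup : τ.plus ⊔ (ℚ ∙ m) = ⊤ := by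
      apply Submodule.eq_top_of_finrank_eq
      rw [QuaternionAlgebra.finrank_eq_four]
      have h1 : τ.plus < τ.plus ⊔ (ℚ ∙ m) := by
        refine lt_of_le_of_ne le_sup_left fun h => hmn ?_
        rw [h]
        exact Submodule.mem_sup_right (Submodule.mem_span_singleton_self m)
      have h2 := Submodule.finrank_lt_finrank_of_lt h1
      have h3 := Submodule.finrank_le (τ.plus ⊔ (ℚ ∙ m))
      rw [QuaternionAlgebra.finrank_eq_four] at h3
      have h4 : Module.finrank ℚ τ.plus = 3 := hτ
      omega
    intro x
    have hx : x ∈ τ.plus ⊔ (ℚ ∙ m) := hsup ▸ Submodule.mem_top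
    obtain ⟨p, hp, z, hz, rfl⟩ := Submodule.mem_sup.1 hx
    obtain ⟨c, rfl⟩ := Submodule.mem_span_singleton.1 hz
    exact ⟨p, hp, c, rfl⟩
  obtain ⟨μ, hsq⟩ : ∃ μ, m * m = algebraMap ℚ _ μ :=
    ⟨_, QuaternionAlgebra.mul_self_of_re_eq_zero hmre⟩
  refine ⟨m, μ, ?_, hsq, hstar, ?_⟩
  · intro hμ
    rw [hμ, map_zero] at hsq
    -- `m` would lie in the radical of the norm form
    have hrad : ∀ x : ℍ[ℚ,a,b], (x * m).re = 0 := by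
      intro x
      obtain ⟨p, hp, c, rfl⟩ := hspan x
      have := congrArg QuaternionAlgebra.re (hcomm p hp)
      rw [add_mul, smul_mul_assoc, hsq]
      simp [hmre] at this ⊢
      linarith
    apply hm0
    have h1 := hrad ⟨0, 1, 0, 0⟩
    have h2 := hrad ⟨0, 0, 1, 0⟩
    have h3 := hrad ⟨0, 0, 0, 1⟩
    simp [ha, hb] at h1 h2 h3
    ext <;> simp [hmre, h1, h2, h3]
  · intro x
    obtain ⟨p, hp, c, rfl⟩ := hspan x
    have h4 : τ.toLinearMap p = p := hp
    rw [star_add, mul_add, hcomm p hp, map_add, map_smul, hm, h4, star_smul, hstar, add_mul,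
      mul_assoc p, hsq]
    simp only [mul_smul_comm, smul_mul_assoc, mul_neg, neg_mul, hsq,
      Algebra.algebraMap_eq_smul_one, smul_add, smul_neg, mul_one, one_mul, smul_comm μ c, star_trivial]

end QuaternionInvolution

/-! ### The matrix model of the Clifford algebra of `q_H`. -/

section CliffordModel

variable {a b : ℚ} {τ : AlgInvolution ℍ[ℚ,a,b]} {m : ℍ[ℚ,a,b]} {μ : ℚ}

namespace AlgInvolution.IsTwist

theorem mul_star_of_mem_plus (h : τ.IsTwist m μ) {x : ℍ[ℚ,a,b]} (hx : x ∈ τ.plus) :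
    m * star x = x * m := by
  have h1 := h.apply_eq x
  rw [τ.mem_plus.1 hx] at h1
  have h2 := congrArg (· * m) h1
  simp only [smul_mul_assoc, mul_assoc, h.mul_self, Algebra.algebraMap_eq_smul_one,
    mul_smul_comm, mul_one] at h2
  exact (smul_right_injective _ h.ne_zero h2).symm

/-- Being fixed means `m x̄ = x m`; as `star (x m) = -(m x̄)`, this says that `x m` is pure. Thus
`H⁺` is the hyperplane orthogonal to `m` for the trace form. -/
theorem mem_plus_of_re_eq_zero (h : τ.IsTwist m μ) {x : ℍ[ℚ,a,b]} (hx : (x * m).re = 0) :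
    x ∈ τ.plus := by
  have h1 : m * star x = x * m := by
    have := QuaternionAlgebra.star_eq_neg_of_re_eq_zero hx
    rw [star_mul, h.star_eq, neg_mul, neg_inj] at this
    exact this
  rw [τ.mem_plus]
  apply smul_right_injective _ h.ne_zero
  simp only [h.apply_eq, h1, mul_assoc, h.mul_self, Algebra.algebraMap_eq_smul_one,
    mul_smul_comm, mul_one]

theorem mul_of_mem_plus (h : τ.IsTwist m μ) {x : ℍ[ℚ,a,b]} (hx : x ∈ τ.plus) :
    m * x = star x * m := by
  have h1 := h.mul_star_of_mem_plus hx
  have hs : star x = algebraMap ℚ _ (2 * x.re) - x := by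
    ext <;> simp [QuaternionAlgebra.algebraMap_eq]; ring
  rw [hs, mul_sub, ← Algebra.commutes] at h1
  rw [hs, sub_mul, ← h1, sub_sub_cancel]

theorem apply_self (h : τ.IsTwist m μ) : τ.toLinearMap m = -m := by
  apply smul_right_injective _ h.ne_zero
  simp only [h.apply_eq, h.star_eq, mul_neg, neg_mul, h.mul_self, Algebra.algebraMap_eq_smul_one,
    smul_mul_assoc, one_mul, smul_neg]

end AlgInvolution.IsTwist

/-- Vectors of `q_H` as `2 × 2` matrices over `H`; the square is `μ · q_H`. -/
def vectorMatrix (τ : AlgInvolution ℍ[ℚ,a,b]) (m : ℍ[ℚ,a,b]) :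
    ((ℚ × ℚ) × τ.plus) →ₗ[ℚ] Matrix (Fin 2) (Fin 2) ℍ[ℚ,a,b] where
  toFun v := !![v.2.1 * m, -(v.1.1 • m); v.1.2 • m, -(m * v.2.1)]
  map_add' v w := by
    ext i j : 1
    fin_cases i <;> fin_cases j <;> simp [add_mul, mul_add, add_smul, add_comm]
  map_smul' c v := by
    ext i j : 1
    fin_cases i <;> fin_cases j <;> simp [mul_smul]

theorem vectorMatrix_apply (v : (ℚ × ℚ) × τ.plus) : vectorMatrix τ m v =
    !![v.2.1 * m, -(v.1.1 • m); v.1.2 • m, -(m * v.2.1)] := rfl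

theorem vectorMatrix_mul_self (h : τ.IsTwist m μ) (v : (ℚ × ℚ) × τ.plus) :
    vectorMatrix τ m v * vectorMatrix τ m v =
      (μ * inversiveForm τ v) • (1 : Matrix (Fin 2) (Fin 2) ℍ[ℚ,a,b]) := by
  obtain ⟨⟨k, k'⟩, x, hx⟩ := v
  have h1 := h.mul_star_of_mem_plus hx
  have h2 := h.mul_of_mem_plus hx
  have hn : x * star x = nrm a b x • (1 : ℍ[ℚ,a,b]) := by
    rw [← nrm_spec, Algebra.algebraMap_eq_smul_one]
  have hn' : star x * x = nrm a b x • (1 : ℍ[ℚ,a,b]) := by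
    rw [← hn]; ext <;> simp <;> ring
  have hm : m * m = μ • (1 : ℍ[ℚ,a,b]) := by
    rw [h.mul_self, Algebra.algebraMap_eq_smul_one]
  have e1 : x * m * (x * m) = (μ * nrm a b x) • (1 : ℍ[ℚ,a,b]) := by
    rw [mul_assoc, ← mul_assoc m, h2, mul_assoc (star x), hm, mul_smul_comm, mul_smul_comm,
      mul_one, hn, smul_smul]
  have e2 : m * x * (m * x) = (μ * nrm a b x) • (1 : ℍ[ℚ,a,b]) := by
    rw [mul_assoc, ← mul_assoc x, ← h1, mul_assoc m, hn', ← mul_assoc, hm, smul_mul_smul, one_mul]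
  have e3 : x * m * m = μ • x := by rw [mul_assoc, hm, mul_smul_comm, mul_one]
  have e4 : m * (m * x) = μ • x := by rw [← mul_assoc, hm, smul_mul_assoc, one_mul]
  rw [inversiveForm_apply, vectorMatrix_apply]
  ext i j : 1
  fin_cases i <;> fin_cases j <;>
    simp only [Matrix.mul_apply, Fin.sum_univ_two, Fin.zero_eta, Fin.mk_one, Matrix.of_apply,
      Matrix.cons_val_zero, Matrix.cons_val_one, Matrix.cons_val', Matrix.cons_val_fin_one,
      Matrix.smul_apply, Matrix.one_apply_eq, mul_neg, neg_mul, neg_neg, mul_smul_comm,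
      smul_mul_assoc, e1, e2, e3, e4, hm, smul_smul, mul_assoc m x m]
  · module
  · simp
  · simp
  · module

/-- The representation of the Clifford algebra of `q_H` on pairs, with even elements diagonal. -/
def cliffordRep (h : τ.IsTwist m μ) : CliffordAlgebra (inversiveForm τ) →ₐ[ℚ]
    Matrix (Fin 2) (Fin 2) (Matrix (Fin 2) (Fin 2) ℍ[ℚ,a,b]) :=
  CliffordAlgebra.lift _
    -- The factor `μ⁻¹` in one corner cancels the `μ` in the square of `vectorMatrix`, so that no
    -- square root of `μ` is needed.
    ⟨{ toFun := fun v => !![0, vectorMatrix τ m v; μ⁻¹ • vectorMatrix τ m v, 0]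
       map_add' := fun v w => by
        ext i j : 1
        fin_cases i <;> fin_cases j <;> simp
       map_smul' := fun c v => by
        ext i j : 1
        fin_cases i <;> fin_cases j <;> simp [smul_comm μ⁻¹ c] }, fun v => by
      have := h.ne_zero
      ext i j : 1
      fin_cases i <;> fin_cases j <;>
        simp [Matrix.mul_apply, vectorMatrix_mul_self h, smul_smul,
          Algebra.algebraMap_eq_smul_one, this]⟩

theorem cliffordRep_ι (h : τ.IsTwist m μ) (v : (ℚ × ℚ) × τ.plus) :
    cliffordRep h (CliffordAlgebra.ι _ v) =
      !![0, vectorMatrix τ m v; μ⁻¹ • vectorMatrix τ m v, 0] :=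
  CliffordAlgebra.lift_ι_apply _ _ _

/-- The diagonal entry of `cliffordRep`. -/
def evenEntry (h : τ.IsTwist m μ) : CliffordAlgebra (inversiveForm τ) →ₗ[ℚ]
    Matrix (Fin 2) (Fin 2) ℍ[ℚ,a,b] where
  toFun x := cliffordRep h x 0 0
  map_add' x y := by simp
  map_smul' c x := by simp

/-- The off-diagonal entry of `cliffordRep`. -/
def oddEntry (h : τ.IsTwist m μ) : CliffordAlgebra (inversiveForm τ) →ₗ[ℚ]
    Matrix (Fin 2) (Fin 2) ℍ[ℚ,a,b] where
  toFun x := cliffordRep h x 0 1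
  map_add' x y := by simp
  map_smul' c x := by simp

/-- The image lies in `Mat(2, H)[ε]`, where `ε = (0, 1; μ⁻¹, 0)` commutes with block-scalar matrices
and `ε² = μ⁻¹`: the generators are multiples of `ε`, and this algebra is closed under products. An
element is therefore determined by its first row. -/
theorem cliffordRep_apply (h : τ.IsTwist m μ) (x : CliffordAlgebra (inversiveForm τ)) :
    cliffordRep h x = !![evenEntry h x, oddEntry h x; μ⁻¹ • oddEntry h x, evenEntry h x] := by
  have key : cliffordRep h x 1 0 = μ⁻¹ • cliffordRep h x 0 1 ∧
      cliffordRep h x 1 1 = cliffordRep h x 0 0 := by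
    induction x using CliffordAlgebra.induction with
    | algebraMap r => simp [Matrix.algebraMap_matrix_apply]
    | ι v => simp [cliffordRep_ι]
    | add x y hx hy => simp [hx, hy]
    | mul x y hx hy =>
      simp only [map_mul, Matrix.mul_apply, Fin.sum_univ_two, hx, hy, smul_mul_assoc,
        mul_smul_comm, smul_add]
      exact ⟨add_comm _ _, add_comm _ _⟩
  ext i j : 1
  fin_cases i <;> fin_cases j <;> simp [evenEntry, oddEntry, key]

section

variable (h : τ.IsTwist m μ) (x y : CliffordAlgebra (inversiveForm τ)) (v : (ℚ × ℚ) × τ.plus)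

theorem evenEntry_mul : evenEntry h (x * y) =
    evenEntry h x * evenEntry h y + μ⁻¹ • (oddEntry h x * oddEntry h y) := by
  change cliffordRep h (x * y) 0 0 = _
  rw [map_mul, cliffordRep_apply h x, cliffordRep_apply h y]
  simp [Matrix.mul_apply]

theorem oddEntry_mul : oddEntry h (x * y) =
    evenEntry h x * oddEntry h y + oddEntry h x * evenEntry h y := by
  change cliffordRep h (x * y) 0 1 = _
  rw [map_mul, cliffordRep_apply h x, cliffordRep_apply h y]
  simp [Matrix.mul_apply]

theorem evenEntry_one : evenEntry h 1 = 1 := by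
  change cliffordRep h 1 0 0 = _
  simp

theorem oddEntry_one : oddEntry h 1 = 0 := by
  change cliffordRep h 1 0 1 = _
  simp

theorem evenEntry_ι : evenEntry h (CliffordAlgebra.ι _ v) = 0 := by
  change cliffordRep h (CliffordAlgebra.ι _ v) 0 0 = _
  simp [cliffordRep_ι]

theorem oddEntry_ι : oddEntry h (CliffordAlgebra.ι _ v) = vectorMatrix τ m v := by
  change cliffordRep h (CliffordAlgebra.ι _ v) 0 1 = _
  simp [cliffordRep_ι]

theorem entries_involute : evenEntry h (CliffordAlgebra.involute x) = evenEntry h x ∧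
    oddEntry h (CliffordAlgebra.involute x) = -oddEntry h x := by
  induction x using CliffordAlgebra.induction with
  | algebraMap r => simp [Algebra.algebraMap_eq_smul_one, oddEntry_one]
  | ι v => simp [evenEntry_ι]
  | add x y hx hy => simp [hx, hy, add_comm]
  | mul x y hx hy =>
    simp only [map_mul, evenEntry_mul, oddEntry_mul, hx, hy, neg_mul, mul_neg, neg_neg, neg_add,
      true_and]

end

/-- The linear map `(a, b; c, d) ↦ (d‡, -b‡; -c‡, a‡)` over `ℚ`. -/
def AlgInvolution.adjLinear {H : Type} [Ring H] [Algebra ℚ H] (τ : AlgInvolution H) :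
    Matrix (Fin 2) (Fin 2) H →ₗ[ℚ] Matrix (Fin 2) (Fin 2) H where
  toFun M := !![τ.toLinearMap (M 1 1), -τ.toLinearMap (M 0 1);
    -τ.toLinearMap (M 1 0), τ.toLinearMap (M 0 0)]
  map_add' M N := by
    ext i j
    fin_cases i <;> fin_cases j <;> simp [add_comm]
  map_smul' c M := by
    ext i j
    fin_cases i <;> fin_cases j <;> simp

theorem AlgInvolution.adjLinear_apply {H : Type} [Ring H] [Algebra ℚ H] (τ : AlgInvolution H)
    (M : Matrix (Fin 2) (Fin 2) H) : τ.adjLinear M =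
      !![τ.toLinearMap (M 1 1), -τ.toLinearMap (M 0 1);
        -τ.toLinearMap (M 1 0), τ.toLinearMap (M 0 0)] := rfl

theorem AlgInvolution.adjLinear_mul {H : Type} [Ring H] [Algebra ℚ H] (τ : AlgInvolution H)
    (M N : Matrix (Fin 2) (Fin 2) H) :
    τ.adjLinear (M * N) = τ.adjLinear N * τ.adjLinear M := by
  ext i j
  fin_cases i <;> fin_cases j <;>
    simp [adjLinear_apply, Matrix.mul_apply, Fin.sum_univ_two, toLinearMap_mul] <;> abel

theorem AlgInvolution.adjLinear_one {H : Type} [Ring H] [Algebra ℚ H] (τ : AlgInvolution H) :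
    τ.adjLinear 1 = 1 := by
  ext i j
  fin_cases i <;> fin_cases j <;> simp [adjLinear_apply, toLinearMap_one]

theorem adjLinear_vectorMatrix (h : τ.IsTwist m μ) (v : (ℚ × ℚ) × τ.plus) :
    τ.adjLinear (vectorMatrix τ m v) = vectorMatrix τ m v := by
  obtain ⟨⟨k, k'⟩, x, hx⟩ := v
  rw [τ.mem_plus] at hx
  ext i j : 1
  fin_cases i <;> fin_cases j <;>
    simp [AlgInvolution.adjLinear_apply, vectorMatrix_apply, τ.toLinearMap_mul, h.apply_self, hx]

/-- Reversal and `adjLinear`, applied coefficientwise, are both anti-multiplicative, and both fix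
the vectors, which generate. -/
theorem entries_reverse (h : τ.IsTwist m μ) (x : CliffordAlgebra (inversiveForm τ)) :
    evenEntry h (CliffordAlgebra.reverse x) = τ.adjLinear (evenEntry h x) ∧
    oddEntry h (CliffordAlgebra.reverse x) = τ.adjLinear (oddEntry h x) := by
  induction x using CliffordAlgebra.induction with
  | algebraMap r =>
    simp [Algebra.algebraMap_eq_smul_one, oddEntry_one, evenEntry_one, τ.adjLinear_one]
  | ι v => simp [evenEntry_ι, oddEntry_ι, adjLinear_vectorMatrix h]
  | add x y hx hy => simp [hx, hy]
  | mul x y hx hy =>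
    simp only [CliffordAlgebra.reverse.map_mul, evenEntry_mul, oddEntry_mul, hx, hy,
      τ.adjLinear_mul, map_add, map_smul, true_and]
    exact add_comm _ _

/-- The fixed points of `adj` of trace zero are the images of vectors. -/
theorem exists_vectorMatrix_eq (h : τ.IsTwist m μ) {Z : Matrix (Fin 2) (Fin 2) ℍ[ℚ,a,b]} (hZ : τ.adjLinear Z = Z)
    (htr : (Z 0 0 + Z 1 1).re = 0) : ∃ v, vectorMatrix τ m v = Z := by
  have hm : m * m = μ • (1 : ℍ[ℚ,a,b]) := by
    rw [h.mul_self, Algebra.algebraMap_eq_smul_one]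
  have hμ := h.ne_zero
  rw [← Matrix.ext_iff] at hZ
  simp only [τ.adjLinear_apply, Fin.forall_fin_two, Matrix.of_apply, Matrix.cons_val_zero,
    Matrix.cons_val_one, Matrix.cons_val', Matrix.cons_val_fin_one] at hZ
  obtain ⟨⟨h00, h01⟩, h10, h11⟩ := hZ
  -- The `(-1)`-eigenspace of `τ` is the line `ℚ m`: for such `z` the product `z m` is fixed by
  -- conjugation, hence rational.
  have hoff : ∀ z, -τ.toLinearMap z = z → ∃ k : ℚ, k • m = z := by
    intro z hz
    have h1 := h.apply_eq z
    rw [← neg_eq_iff_eq_neg.2 hz.symm] at h1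
    have h2 : star (z * m) = z * m := by
      have h3 := congrArg (· * m) h1
      simp only [mul_assoc, hm, mul_smul_comm, mul_one, smul_neg, neg_mul, smul_mul_assoc] at h3
      rw [← smul_neg] at h3
      have h4 := smul_right_injective _ hμ h3
      rw [star_mul, h.star_eq, neg_mul]
      rw [← h4, neg_neg]
    have h3 : z * m = (z * m).re • (1 : ℍ[ℚ,a,b]) := by
      have e1 := congrArg QuaternionAlgebra.imI h2
      have e2 := congrArg QuaternionAlgebra.imJ h2
      have e3 := congrArg QuaternionAlgebra.imK h2
      generalize z * m = w at e1 e2 e3 ⊢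
      simp at e1 e2 e3
      ext <;> simp <;> linarith
    refine ⟨μ⁻¹ * (z * m).re, ?_⟩
    have h4 := congrArg (· * m) h3
    simp only [mul_assoc, hm, mul_smul_comm, mul_one, smul_mul_assoc, one_mul] at h4
    rw [mul_smul, ← h4, smul_smul, inv_mul_cancel₀ hμ, one_smul]
  obtain ⟨k, hk⟩ := hoff _ h01
  obtain ⟨k', hk'⟩ := hoff _ h10
  -- The diagonal entries are exchanged by `τ`, so their real parts agree; trace zero makes both
  -- vanish. This is the one place where the trace condition enters: it removes the scalar matrices.
  have hre : (Z 0 0).re = 0 := by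
    have := τ.re_toLinearMap (Z 1 1)
    rw [h00] at this
    rw [QuaternionAlgebra.re_add] at htr
    linarith
  have hstar := QuaternionAlgebra.star_eq_neg_of_re_eq_zero hre
  have hx : (μ⁻¹ • (Z 0 0 * m)) * m = Z 0 0 := by
    rw [smul_mul_assoc, mul_assoc, hm, mul_smul_comm, mul_one, smul_smul, inv_mul_cancel₀ hμ,
      one_smul]
  -- The sign on `k` matches the upper right entry `-κ m` of `vectorMatrix`.
  refine ⟨((-k, k'), ⟨μ⁻¹ • (Z 0 0 * m), h.mem_plus_of_re_eq_zero (by rw [hx, hre])⟩), ?_⟩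
  ext i j : 1
  fin_cases i <;> fin_cases j
  · simpa [vectorMatrix_apply] using hx
  · simpa [vectorMatrix_apply] using hk
  · simpa [vectorMatrix_apply] using hk'
  · apply smul_right_injective _ hμ
    have h5 := h.apply_eq (Z 0 0)
    rw [h11, hstar] at h5
    simp [vectorMatrix_apply, h5, smul_smul, hμ, mul_assoc]

end CliffordModel

/-! ### The even Clifford algebra is `Mat(2, H)`. -/

section EvenSplitting

theorem eq_zero_of_neg_eq_self {M : Type} [AddCommGroup M] [Module ℚ M] {x : M} (h : -x = x) :
    x = 0 := by
  have h2 : (2 : ℚ) • x = 0 := by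
    rw [two_smul]
    nth_rewrite 1 [← h]
    exact neg_add_cancel x
  exact (smul_eq_zero.1 h2).resolve_left two_ne_zero

/-- With 2 invertible, the Clifford algebra is linearly isomorphic to the exterior algebra. -/
theorem CliffordAlgebra.finrank_eq_two_pow {V : Type} [AddCommGroup V] [Module ℚ V]
    [Module.Finite ℚ V] (Q : QuadraticForm ℚ V) :
    Module.Finite ℚ (CliffordAlgebra Q) ∧
      Module.finrank ℚ (CliffordAlgebra Q) = 2 ^ Module.finrank ℚ V := by
  let e := (CliffordAlgebra.equivExterior Q).symm
  let B := (Module.finBasis ℚ V).ExteriorAlgebra.map e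
  exact ⟨Module.Finite.of_basis B, by simp [Module.finrank_eq_card_basis B]⟩

theorem CliffordAlgebra.mem_even_iff_involute {V : Type} [AddCommGroup V] [Module ℚ V]
    {Q : QuadraticForm ℚ V} {x : CliffordAlgebra Q} :
    x ∈ CliffordAlgebra.even Q ↔ CliffordAlgebra.involute x = x := by
  refine ⟨fun hx => CliffordAlgebra.involute_eq_of_mem_even hx, fun hx => ?_⟩
  have hx' : x ∈ CliffordAlgebra.evenOdd Q 0 ⊔ CliffordAlgebra.evenOdd Q 1 := by
    rw [(CliffordAlgebra.evenOdd_isCompl Q).sup_eq_top]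
    exact Submodule.mem_top
  obtain ⟨y, hy, z, hz, rfl⟩ := Submodule.mem_sup.1 hx'
  rw [map_add, CliffordAlgebra.involute_eq_of_mem_even hy,
    CliffordAlgebra.involute_eq_of_mem_odd hz, add_right_inj] at hx
  rwa [eq_zero_of_neg_eq_self hx, add_zero]

variable {a b : ℚ} {τ : AlgInvolution ℍ[ℚ,a,b]} {m : ℍ[ℚ,a,b]} {μ : ℚ}

/-- The fixed space of the involution generates the quaternion algebra. -/
theorem AlgInvolution.IsTwist.subalgebra_eq_top (ha : a ≠ 0) (hb : b ≠ 0) (h : τ.IsTwist m μ)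
    {S : Subalgebra ℚ ℍ[ℚ,a,b]} (hS : ∀ x ∈ τ.plus, x ∈ S) : S = ⊤ := by
  have hre : m.re = 0 := by
    have := congrArg QuaternionAlgebra.re h.star_eq
    simp at this
    linarith
  have hm0 : m ≠ 0 := by
    rintro rfl
    have := congrArg QuaternionAlgebra.re h.mul_self
    simp [QuaternionAlgebra.algebraMap_eq] at this
    exact h.ne_zero this.symm
  -- Commutators with `m` are orthogonal to `m` under the trace form, hence lie in `H⁺`.
  have hcomm : ∀ y, m * y - y * m ∈ S := fun y => hS _ <| h.mem_plus_of_re_eq_zero <| by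
    rw [sub_mul, mul_assoc y, h.mul_self]
    simp [hre, QuaternionAlgebra.algebraMap_eq]
    have := congrArg QuaternionAlgebra.re h.mul_self
    simp [hre, QuaternionAlgebra.algebraMap_eq] at this
    rw [← this]
    ring
  have hscal : ∀ c : ℚ, ∀ x y : ℍ[ℚ,a,b], c ≠ 0 → x * y = algebraMap ℚ _ (x * y).re + c • m →
      x ∈ S → y ∈ S → m ∈ S := by
    intro c x y hc hxy hx hy
    have : m = c⁻¹ • (x * y - algebraMap ℚ _ (x * y).re) := by
      rw [← eq_sub_iff_add_eq'.2 hxy.symm, smul_smul, inv_mul_cancel₀ hc, one_smul]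
    rw [this]
    exact S.smul_mem (S.sub_mem (S.mul_mem hx hy) (S.algebraMap_mem _)) _
  -- A product of two commutators of `m` with distinct basis elements among `i, j, k` is a scalar
  -- plus `±4ab` times the remaining coordinate of `m`, times `m`. Some coordinate of `m` is
  -- nonzero, which dictates the choice of pair.
  have hm : m ∈ S := by
    by_cases h1 : m.imI = 0
    · by_cases h2 : m.imJ = 0
      · have h3 : m.imK ≠ 0 := fun h3 => hm0 (by ext <;> simp [hre, h1, h2, h3])
        refine hscal (4 * a * b * m.imK) _ _ (by simp [ha, hb, h3]) ?_
          (hcomm ⟨0, 1, 0, 0⟩) (hcomm ⟨0, 0, 1, 0⟩)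
        ext <;> simp [hre, h1, h2, QuaternionAlgebra.algebraMap_eq]; ring
      · refine hscal (-4 * a * b * m.imJ) _ _ (by simp [ha, hb, h2]) ?_
          (hcomm ⟨0, 1, 0, 0⟩) (hcomm ⟨0, 0, 0, 1⟩)
        ext <;> simp [hre, h1, QuaternionAlgebra.algebraMap_eq] <;> ring
    · refine hscal (4 * a * b * m.imI) _ _ (by simp [ha, hb, h1]) ?_
          (hcomm ⟨0, 0, 1, 0⟩) (hcomm ⟨0, 0, 0, 1⟩)
      ext <;> simp [hre, QuaternionAlgebra.algebraMap_eq] <;> ring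
  rw [eq_top_iff]
  intro x _
  -- Orthogonal projection along `m`, using `m² = μ`.
  have hx : x - (μ⁻¹ * (x * m).re) • m ∈ τ.plus := h.mem_plus_of_re_eq_zero <| by
    rw [sub_mul, smul_mul_assoc, h.mul_self, QuaternionAlgebra.re_sub, QuaternionAlgebra.re_smul]
    simp only [QuaternionAlgebra.algebraMap_eq, smul_eq_mul]
    field_simp [h.ne_zero]
    ring
  have := S.add_mem (hS _ hx) (S.smul_mem hm (μ⁻¹ * (x * m).re))
  rwa [sub_add_cancel] at this

theorem one_mem_plus : (1 : ℍ[ℚ,a,b]) ∈ τ.plus := τ.toLinearMap_one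

/-- The subalgebra of values of `evenEntry` on elements with vanishing `oddEntry`. -/
def evenImage (h : τ.IsTwist m μ) : Subalgebra ℚ (Matrix (Fin 2) (Fin 2) ℍ[ℚ,a,b]) where
  carrier := {M | ∃ x, evenEntry h x = M ∧ oddEntry h x = 0}
  mul_mem' := by
    rintro _ _ ⟨x, rfl, hx⟩ ⟨y, rfl, hy⟩
    exact ⟨x * y, by simp [evenEntry_mul, hx], by simp [oddEntry_mul, hx, hy]⟩
  add_mem' := by
    rintro _ _ ⟨x, rfl, hx⟩ ⟨y, rfl, hy⟩
    exact ⟨x + y, by simp, by simp [hx, hy]⟩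
  algebraMap_mem' r := ⟨algebraMap ℚ _ r, by
    simp [Algebra.algebraMap_eq_smul_one, evenEntry_one], by
    simp [Algebra.algebraMap_eq_smul_one, oddEntry_one]⟩

theorem vectorMatrix_mul_mem (h : τ.IsTwist m μ) (v w : (ℚ × ℚ) × τ.plus) :
    vectorMatrix τ m v * vectorMatrix τ m w ∈ evenImage h := by
  -- The factor `μ` cancels the `μ⁻¹` in `evenEntry_mul`.
  refine ⟨μ • (CliffordAlgebra.ι _ v * CliffordAlgebra.ι _ w), ?_, ?_⟩
  · simp [evenEntry_mul, evenEntry_ι, oddEntry_ι, smul_smul, h.ne_zero]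
  · simp [oddEntry_mul, evenEntry_ι]

open Matrix in
theorem evenImage_eq_top (ha : a ≠ 0) (hb : b ≠ 0) (h : τ.IsTwist m μ) : evenImage h = ⊤ := by
  have hμ := h.ne_zero
  have hm : m * m = μ • (1 : ℍ[ℚ,a,b]) := by
    rw [h.mul_self, Algebra.algebraMap_eq_smul_one]
  have hscale : ∀ M : Matrix (Fin 2) (Fin 2) ℍ[ℚ,a,b], μ • M ∈ evenImage h →
      M ∈ evenImage h := by
    intro M hM
    have := (evenImage h).smul_mem hM μ⁻¹
    rwa [smul_smul, inv_mul_cancel₀ hμ, one_smul] at this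
  -- The vector with `ξ = 1` has matrix `diag(m, -m)`; multiplying it by the two isotropic vectors
  -- yields `μ` times the off-diagonal matrix units.
  have h01 : (single 0 1 1 : Matrix (Fin 2) (Fin 2) ℍ[ℚ,a,b]) ∈ evenImage h := by
    apply hscale
    convert! vectorMatrix_mul_mem h ((1, 0), 0) ((0, 0), ⟨1, one_mem_plus⟩) using 1
    ext i j : 1
    fin_cases i <;> fin_cases j <;> simp [vectorMatrix_apply, Matrix.mul_apply, hm]
  have h10 : (single 1 0 1 : Matrix (Fin 2) (Fin 2) ℍ[ℚ,a,b]) ∈ evenImage h := by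
    apply hscale
    convert! vectorMatrix_mul_mem h ((0, 1), 0) ((0, 0), ⟨1, one_mem_plus⟩) using 1
    ext i j : 1
    fin_cases i <;> fin_cases j <;> simp [vectorMatrix_apply, Matrix.mul_apply, hm]
  have h00 : (single 0 0 1 : Matrix (Fin 2) (Fin 2) ℍ[ℚ,a,b]) ∈ evenImage h := by
    simpa using mul_mem h01 h10
  have hplus : ∀ x ∈ τ.plus, single 0 0 x ∈ evenImage h := by
    intro x hx
    apply hscale
    convert! mul_mem (vectorMatrix_mul_mem h ((0, 0), ⟨x, hx⟩) ((0, 0), ⟨1, one_mem_plus⟩)) h00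
      using 1
    ext i j : 1
    fin_cases i <;> fin_cases j <;>
      simp [vectorMatrix_apply, Matrix.mul_apply, hm, single_apply, mul_assoc]
  let S : Subalgebra ℚ ℍ[ℚ,a,b] :=
    { carrier := {x | single 0 0 x ∈ evenImage h}
      mul_mem' := fun {x y} hx hy => by
        have := (evenImage h).mul_mem hx hy
        rwa [single_mul_single_same] at this
      add_mem' := fun {x y} hx hy => by
        have := (evenImage h).add_mem hx hy
        rwa [← single_add] at this
      algebraMap_mem' := fun r => by
        have := (evenImage h).smul_mem h00 r
        rwa [smul_single, ← Algebra.algebraMap_eq_smul_one] at this }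
  have hS : S = ⊤ := h.subalgebra_eq_top ha hb hplus
  have hall : ∀ x, single 0 0 x ∈ evenImage h := fun x => by
    have : x ∈ S := hS ▸ Algebra.mem_top
    exact this
  rw [eq_top_iff]
  intro M _
  induction M using Matrix.induction_on' with
  | h_zero => exact zero_mem _
  | h_add p q hp hq => exact add_mem (hp trivial) (hq trivial)
  | h_std_basis i j x =>
    fin_cases i <;> fin_cases j
    · exact hall x
    · simpa using mul_mem (hall x) h01
    · simpa using mul_mem h10 (hall x)
    · simpa using mul_mem (mul_mem h10 (hall x)) h01

theorem entries_bijective (ha : a ≠ 0) (hb : b ≠ 0) (hτ : τ.IsOrthogonal) (h : τ.IsTwist m μ) :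
    Function.Bijective ((evenEntry h).prod (oddEntry h)) := by
  have hsurj : Function.Surjective ((evenEntry h).prod (oddEntry h)) := by
    have hE : ∀ M, ∃ x, evenEntry h x = M ∧ oddEntry h x = 0 := fun M => by
      have : M ∈ evenImage h := evenImage_eq_top ha hb h ▸ Algebra.mem_top
      exact this
    -- The vector with `ξ = 1` is invertible, as `P² = μ`; multiplying by it carries surjectivity
    -- from the even part to the odd part.
    set P := vectorMatrix τ m ((0, 0), ⟨1, one_mem_plus⟩) with hP
    have hPP : P * P = μ • (1 : Matrix (Fin 2) (Fin 2) ℍ[ℚ,a,b]) := by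
      rw [vectorMatrix_mul_self h, inversiveForm_apply]
      simp [nrm]
    rintro ⟨M, N⟩
    obtain ⟨x, hx, hx'⟩ := hE M
    obtain ⟨y, hy, hy'⟩ := hE (μ⁻¹ • (N * P))
    refine ⟨x + y * CliffordAlgebra.ι _ ((0, 0), ⟨1, one_mem_plus⟩), Prod.ext ?_ ?_⟩
    · simp [evenEntry_mul, evenEntry_ι, hx, hy']
    · simp [oddEntry_mul, oddEntry_ι, hx', hy', hy, ← hP, mul_assoc, hPP, smul_smul, h.ne_zero]
  obtain ⟨hfin, hdim⟩ := CliffordAlgebra.finrank_eq_two_pow (inversiveForm τ)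
  refine ⟨(LinearMap.injective_iff_surjective_of_finrank_eq_finrank ?_).2 hsurj, hsurj⟩
  -- The dimensions agree: `2 ^ (2 + 3) = 32 = 2 · (4 · 4)`.
  have h3 : Module.finrank ℚ τ.plus = 3 := hτ
  rw [hdim]
  simp [Module.finrank_matrix, QuaternionAlgebra.finrank_eq_four, h3]

/-- This packages all that base change requires, with no reference to `m` and `μ`. The functional
`l` is the trace of the odd coefficient: it is cyclic against even elements, and among odd elements
fixed by reversal it vanishes exactly on the vectors. -/
theorem exists_even_splitting (ha : a ≠ 0) (hb : b ≠ 0) (hτ : τ.IsOrthogonal) :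
    ∃ (j : Matrix (Fin 2) (Fin 2) ℍ[ℚ,a,b] →ₐ[ℚ] CliffordAlgebra (inversiveForm τ))
      (l : CliffordAlgebra (inversiveForm τ) →ₗ[ℚ] ℚ),
      Function.Injective j ∧
      j.range = CliffordAlgebra.even (inversiveForm τ) ∧
      (∀ M, CliffordAlgebra.reverse (j M) = j (τ.adjLinear M)) ∧
      (∀ M y, l (j M * y) = l (y * j M)) ∧
      ∀ y, y ∈ LinearMap.range (CliffordAlgebra.ι (inversiveForm τ)) ↔
        CliffordAlgebra.involute y = -y ∧ CliffordAlgebra.reverse y = y ∧ l y = 0 := by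
  obtain ⟨m, μ, h⟩ := τ.exists_isTwist ha hb hτ
  let e := LinearEquiv.ofBijective _ (entries_bijective ha hb hτ h)
  have hext : ∀ x y, evenEntry h x = evenEntry h y → oddEntry h x = oddEntry h y → x = y :=
    fun x y h1 h2 => e.injective (Prod.ext h1 h2)
  have hE : ∀ M, evenEntry h (e.symm (M, 0)) = M := fun M =>
    congrArg Prod.fst (e.apply_symm_apply (M, 0))
  have hO : ∀ M, oddEntry h (e.symm (M, 0)) = 0 := fun M =>
    congrArg Prod.snd (e.apply_symm_apply (M, 0))
  let j : Matrix (Fin 2) (Fin 2) ℍ[ℚ,a,b] →ₐ[ℚ] CliffordAlgebra (inversiveForm τ) :=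
    AlgHom.ofLinearMap (e.symm.toLinearMap ∘ₗ LinearMap.inl ℚ _ _)
      (hext _ _ ((hE 1).trans (evenEntry_one h).symm) ((hO 1).trans (oddEntry_one h).symm))
      (fun M N => hext _ _ (by simp [evenEntry_mul, hE, hO]) (by simp [oddEntry_mul, hO]))
  replace hE : ∀ M, evenEntry h (j M) = M := hE
  replace hO : ∀ M, oddEntry h (j M) = 0 := hO
  let t : Matrix (Fin 2) (Fin 2) ℍ[ℚ,a,b] →ₗ[ℚ] ℚ :=
    { toFun := fun Z => (Z 0 0 + Z 1 1).re
      map_add' := fun Z W => by simp; ring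
      map_smul' := fun c Z => by simp; ring }
  have ht : ∀ Z W, t (Z * W) = t (W * Z) := fun Z W => by
    simp [t, Matrix.mul_apply]; ring
  refine ⟨j, t ∘ₗ oddEntry h, fun M N hMN => by rw [← hE M, hMN, hE], ?_, ?_, ?_, ?_⟩
  · ext x
    rw [CliffordAlgebra.mem_even_iff_involute]
    obtain ⟨h1, h2⟩ := entries_involute h x
    constructor
    · rintro ⟨M, rfl⟩
      refine hext _ _ h1 (h2.trans ?_)
      change -oddEntry h (j M) = oddEntry h (j M)
      rw [hO, neg_zero]
    · intro hx
      rw [hx] at h2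
      exact ⟨evenEntry h x, hext _ _ (hE _)
        ((hO _).trans (eq_zero_of_neg_eq_self h2.symm).symm)⟩
  · intro M
    obtain ⟨h1, h2⟩ := entries_reverse h (j M)
    exact hext _ _ (by rw [h1, hE, hE]) (by rw [h2, hO, hO, map_zero])
  · intro M y
    simp only [LinearMap.comp_apply, oddEntry_mul, hE, hO, zero_mul, mul_zero, add_zero, zero_add]
    exact ht _ _
  · intro y
    constructor
    · rintro ⟨v, rfl⟩
      refine ⟨by simp, by simp, ?_⟩
      simp [t, oddEntry_ι, vectorMatrix_apply]
      ring
    · rintro ⟨h1, h2, h3⟩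
      have h4 := (entries_involute h y).1
      rw [h1, map_neg] at h4
      have h5 := (entries_reverse h y).2
      rw [h2] at h5
      obtain ⟨v, hv⟩ := exists_vectorMatrix_eq h h5.symm h3
      exact ⟨v, hext _ _ (by rw [evenEntry_ι, eq_zero_of_neg_eq_self h4]) (by rw [oddEntry_ι, hv])⟩

end EvenSplitting

/-! ### Extension of scalars and the isomorphism of group functors. -/

section BaseChange

variable {H : Type} [Ring H] [Algebra ℚ H] (R : Type) [CommRing R] [Algebra ℚ R]

/-- The isomorphism `Mat(2, R ⊗ H) ≃ R ⊗ Mat(2, H)`. -/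
def matrixTensorEquiv : Matrix (Fin 2) (Fin 2) (R ⊗[ℚ] H) ≃ₐ[ℚ]
    R ⊗[ℚ] Matrix (Fin 2) (Fin 2) H :=
  ((matrixEquivTensor (Fin 2) ℚ (R ⊗[ℚ] H)).trans
    (Algebra.TensorProduct.assoc ℚ ℚ ℚ R H (Matrix (Fin 2) (Fin 2) ℚ))).trans
    (Algebra.TensorProduct.congr AlgEquiv.refl (matrixEquivTensor (Fin 2) ℚ H).symm)

theorem matrixTensorEquiv_single (i j : Fin 2) (r : R) (h : H) :
    matrixTensorEquiv R (Matrix.single i j (r ⊗ₜ[ℚ] h)) = r ⊗ₜ Matrix.single i j h := by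
  have h1 : (matrixEquivTensor (Fin 2) ℚ H).symm (h ⊗ₜ Matrix.single i j 1) =
      Matrix.single i j h := by
    rw [AlgEquiv.symm_apply_eq, matrixEquivTensor_apply_single]
  rw [← h1, matrixTensorEquiv, AlgEquiv.trans_apply, AlgEquiv.trans_apply,
    matrixEquivTensor_apply_single, Algebra.TensorProduct.assoc_tmul]
  rfl

variable {R} in
theorem matrix_tensor_induction {p : Matrix (Fin 2) (Fin 2) (R ⊗[ℚ] H) → Prop}
    (M : Matrix (Fin 2) (Fin 2) (R ⊗[ℚ] H)) (zero : p 0)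
    (add : ∀ M N, p M → p N → p (M + N))
    (single : ∀ i j r h, p (Matrix.single i j (r ⊗ₜ h))) : p M := by
  induction M using Matrix.induction_on' with
  | h_zero => exact zero
  | h_add M N hM hN => exact add M N hM hN
  | h_std_basis i j x =>
    induction x using TensorProduct.induction_on with
    | zero => rwa [Matrix.single_zero]
    | tmul r h => exact single i j r h
    | add x y hx hy => rw [Matrix.single_add]; exact add _ _ hx hy

theorem AlgInvolution.adj_add (τ : AlgInvolution H) (M N : Matrix (Fin 2) (Fin 2) (R ⊗[ℚ] H)) :
    τ.adj R (M + N) = τ.adj R M + τ.adj R N := by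
  ext i j
  fin_cases i <;> fin_cases j <;> simp [adj, add_comm]

theorem AlgInvolution.adj_zero (τ : AlgInvolution H) : τ.adj R 0 = 0 := by
  ext i j
  fin_cases i <;> fin_cases j <;> simp [adj]

variable {V : Type} [AddCommGroup V] [Module ℚ V] {Q : QuadraticForm ℚ V}
  (f : Matrix (Fin 2) (Fin 2) H →ₐ[ℚ] CliffordAlgebra Q)

/-- The extension of scalars of an algebra map from `Mat(2, H)` to a Clifford algebra. -/
def cliffordPointHom : Matrix (Fin 2) (Fin 2) (R ⊗[ℚ] H) →ₐ[ℚ] R ⊗[ℚ] CliffordAlgebra Q :=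
  (Algebra.TensorProduct.map (AlgHom.id ℚ R) f).comp (matrixTensorEquiv R).toAlgHom

theorem cliffordPointHom_apply (M : Matrix (Fin 2) (Fin 2) (R ⊗[ℚ] H)) :
    cliffordPointHom R f M =
      Algebra.TensorProduct.map (AlgHom.id ℚ R) f (matrixTensorEquiv R M) := rfl

theorem cliffordPointHom_single (i j : Fin 2) (r : R) (h : H) :
    cliffordPointHom R f (Matrix.single i j (r ⊗ₜ[ℚ] h)) = r ⊗ₜ f (Matrix.single i j h) := by
  rw [cliffordPointHom_apply, matrixTensorEquiv_single, Algebra.TensorProduct.map_tmul]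
  rfl

theorem cliffordPointHom_injective (hf : Function.Injective f) :
    Function.Injective (cliffordPointHom R f) := by
  have h1 : Function.Injective (f.toLinearMap.lTensor R) :=
    Module.Flat.lTensor_preserves_injective_linearMap _ hf
  exact Function.Injective.comp (g := Algebra.TensorProduct.map (AlgHom.id ℚ R) f) h1
    (matrixTensorEquiv R).injective

theorem mem_spinEven_iff (hf : f.range = CliffordAlgebra.even Q) {x : R ⊗[ℚ] CliffordAlgebra Q} :
    x ∈ spinEven Q R ↔ ∃ M, cliffordPointHom R f M = x := by
  constructor
  · rintro ⟨y, rfl⟩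
    induction y using TensorProduct.induction_on with
    | zero => exact ⟨0, by simp⟩
    | add y z hy hz =>
      obtain ⟨M, hM⟩ := hy
      obtain ⟨N, hN⟩ := hz
      exact ⟨M + N, by rw [map_add, hM, hN]; exact (map_add _ _ _).symm⟩
    | tmul r c =>
      obtain ⟨c, hc⟩ := c
      rw [← hf] at hc
      obtain ⟨M, rfl⟩ := hc
      refine ⟨(matrixTensorEquiv R).symm (r ⊗ₜ M), ?_⟩
      rw [cliffordPointHom_apply, AlgEquiv.apply_symm_apply]
      rfl
  · rintro ⟨M, rfl⟩
    induction M using matrix_tensor_induction with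
    | zero => rw [map_zero]; exact zero_mem _
    | add M N hM hN => rw [map_add]; exact add_mem hM hN
    | single i j r h =>
      rw [cliffordPointHom_single]
      exact ⟨r ⊗ₜ ⟨f (Matrix.single i j h), hf ▸ ⟨_, rfl⟩⟩, rfl⟩

theorem spinRev_cliffordPointHom (τ : AlgInvolution H)
    (hf : ∀ M, CliffordAlgebra.reverse (f M) = f (τ.adjLinear M))
    (M : Matrix (Fin 2) (Fin 2) (R ⊗[ℚ] H)) :
    spinRev Q R (cliffordPointHom R f M) = cliffordPointHom R f (τ.adj R M) := by
  induction M using matrix_tensor_induction with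
  | zero => simp [AlgInvolution.adj_zero]
  | add M N hM hN => rw [map_add, map_add, hM, hN, τ.adj_add R, map_add]
  | single i j r h =>
    -- `adj` exchanges the diagonal positions and keeps the off-diagonal ones up to sign. Recording
    -- that `adj` and `adjLinear` move a matrix unit in the same way lets the four cases share the
    -- rewriting below.
    have key : ∃ i' j' h', τ.adj R (Matrix.single i j (r ⊗ₜ[ℚ] h)) =
        Matrix.single i' j' (r ⊗ₜ h') ∧
        τ.adjLinear (Matrix.single i j h) = Matrix.single i' j' h' := by
      fin_cases i <;> fin_cases j
      · refine ⟨1, 1, τ.toLinearMap h, ?_, ?_⟩ <;> ext i j <;> fin_cases i <;> fin_cases j <;>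
          simp [AlgInvolution.adj, AlgInvolution.adjLinear_apply, AlgInvolution.baseExt]
      · refine ⟨0, 1, -τ.toLinearMap h, ?_, ?_⟩ <;> ext i j <;> fin_cases i <;> fin_cases j <;>
          simp [AlgInvolution.adj, AlgInvolution.adjLinear_apply, AlgInvolution.baseExt,
            TensorProduct.tmul_neg]
      · refine ⟨1, 0, -τ.toLinearMap h, ?_, ?_⟩ <;> ext i j <;> fin_cases i <;> fin_cases j <;>
          simp [AlgInvolution.adj, AlgInvolution.adjLinear_apply, AlgInvolution.baseExt,
            TensorProduct.tmul_neg]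
      · refine ⟨0, 0, τ.toLinearMap h, ?_, ?_⟩ <;> ext i j <;> fin_cases i <;> fin_cases j <;>
          simp [AlgInvolution.adj, AlgInvolution.adjLinear_apply, AlgInvolution.baseExt]
    obtain ⟨i', j', h', h1, h2⟩ := key
    rw [h1, cliffordPointHom_single, cliffordPointHom_single, ← h2, ← hf]
    simp [spinRev]

theorem map_cliffordPointHom {R S : Type} [CommRing R] [Algebra ℚ R] [CommRing S] [Algebra ℚ S]
    (g : R →ₐ[ℚ] S) (M : Matrix (Fin 2) (Fin 2) (R ⊗[ℚ] H)) :
    Algebra.TensorProduct.map g (AlgHom.id ℚ (CliffordAlgebra Q)) (cliffordPointHom R f M) =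
      cliffordPointHom S f (M.map (Algebra.TensorProduct.map g (AlgHom.id ℚ H))) := by
  induction M using matrix_tensor_induction with
  | zero => simp
  | add M N hM hN =>
    rw [map_add, map_add, hM, hN, Matrix.map_add _ (map_add _), map_add]
  | single i j r h =>
    rw [Matrix.map_single, Algebra.TensorProduct.map_tmul, cliffordPointHom_single,
      cliffordPointHom_single, Algebra.TensorProduct.map_tmul]
    rfl

/-- Vectors in `R ⊗ Cl(Q)` are cut out by the scalar extensions of the linear conditions which cut
them out in `Cl(Q)`. -/
theorem mem_spinVectors_iff {l : CliffordAlgebra Q →ₗ[ℚ] ℚ}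
    (hl : ∀ y, y ∈ LinearMap.range (CliffordAlgebra.ι Q) ↔
      CliffordAlgebra.involute y = -y ∧ CliffordAlgebra.reverse y = y ∧ l y = 0)
    {y : R ⊗[ℚ] CliffordAlgebra Q} :
    y ∈ spinVectors Q R ↔
      Algebra.TensorProduct.map (AlgHom.id ℚ R) CliffordAlgebra.involute y = -y ∧
        spinRev Q R y = y ∧ l.lTensor R y = 0 := by
  constructor
  · rintro ⟨v, rfl⟩
    induction v using TensorProduct.induction_on with
    | zero => simp
    | add v w hv hw =>
      obtain ⟨h1, h2, h3⟩ := hv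
      obtain ⟨h4, h5, h6⟩ := hw
      refine ⟨?_, ?_, ?_⟩
      · rw [map_add, map_add, h1, h4, neg_add]
      · rw [map_add, map_add, h2, h5]
      · rw [map_add, map_add, h3, h6, add_zero]
    | tmul r v =>
      obtain ⟨h1, h2, h3⟩ := (hl _).1 ⟨v, rfl⟩
      simp [spinRev, h3, TensorProduct.tmul_neg]
  · rintro ⟨h1, h2, h3⟩
    let C := CliffordAlgebra Q
    let L₁ : C →ₗ[ℚ] C := CliffordAlgebra.involute.toLinearMap + LinearMap.id
    let L₂ : C →ₗ[ℚ] C := CliffordAlgebra.reverse - LinearMap.id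
    -- The three conditions are joined into one map with kernel `V`, because flatness preserves the
    -- kernel of a single linear map.
    let L : C →ₗ[ℚ] C × C × ℚ := LinearMap.inl ℚ C (C × ℚ) ∘ₗ L₁ +
      LinearMap.inr ℚ C (C × ℚ) ∘ₗ (LinearMap.inl ℚ C ℚ ∘ₗ L₂ + LinearMap.inr ℚ C ℚ ∘ₗ l)
    have hL : ∀ c, L c = (L₁ c, L₂ c, l c) := fun c => by simp [L]
    have e1 : L₁.lTensor R y = 0 := by
      rw [LinearMap.lTensor_add, LinearMap.lTensor_id]
      change Algebra.TensorProduct.map (AlgHom.id ℚ R) CliffordAlgebra.involute y + y = 0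
      rw [h1, neg_add_cancel]
    have e2 : L₂.lTensor R y = 0 := by
      rw [LinearMap.lTensor_sub, LinearMap.lTensor_id]
      change spinRev Q R y - y = 0
      rw [h2, sub_self]
    have e : L.lTensor R y = 0 := by
      simp only [L, LinearMap.lTensor_add, LinearMap.lTensor_comp, LinearMap.add_apply,
        LinearMap.comp_apply, e1, e2, h3, map_zero, add_zero]
    have hex := Module.Flat.lTensor_exact (M := R) (f := (LinearMap.ker L).subtype) (g := L)
      (LinearMap.exact_subtype_ker_map L)
    obtain ⟨z, rfl⟩ := (hex y).1 e
    clear h1 h2 h3 e1 e2 e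
    induction z using TensorProduct.induction_on with
    | zero => simp [zero_mem]
    | add z w hz hw => rw [map_add]; exact add_mem hz hw
    | tmul r c =>
      obtain ⟨c, hc⟩ := c
      rw [LinearMap.mem_ker, hL] at hc
      simp only [Prod.mk_eq_zero] at hc
      obtain ⟨h1, h2, h3⟩ := hc
      obtain ⟨v, rfl⟩ := (hl c).2 ⟨eq_neg_of_add_eq_zero_left h1, sub_eq_zero.1 h2, h3⟩
      exact ⟨r ⊗ₜ v, rfl⟩

theorem lTensor_cliffordPointHom_mul_comm {l : CliffordAlgebra Q →ₗ[ℚ] ℚ}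
    (hl : ∀ M y, l (f M * y) = l (y * f M)) (M : Matrix (Fin 2) (Fin 2) (R ⊗[ℚ] H))
    (y : R ⊗[ℚ] CliffordAlgebra Q) :
    l.lTensor R (cliffordPointHom R f M * y) = l.lTensor R (y * cliffordPointHom R f M) := by
  induction M using matrix_tensor_induction with
  | zero => simp
  | add M N hM hN => rw [map_add, add_mul, mul_add, map_add, map_add, hM, hN]
  | single i j r h =>
    rw [cliffordPointHom_single]
    induction y using TensorProduct.induction_on with
    | zero => simp
    | add y z hy hz => rw [mul_add, add_mul, map_add, map_add, hy, hz]
    | tmul s c => simp [hl, mul_comm r s]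

/-- Each condition that cuts out the vectors survives conjugation: `M` is even, reversal sends `M`
to its inverse `adj M`, and the trace form is cyclic. Hence the stabiliser condition in `Spin`
imposes nothing further. -/
theorem cliffordPointHom_conj_mem_spinVectors {τ : AlgInvolution H}
    {l : CliffordAlgebra Q →ₗ[ℚ] ℚ}
    (hr : f.range = CliffordAlgebra.even Q)
    (hrev : ∀ M, CliffordAlgebra.reverse (f M) = f (τ.adjLinear M))
    (hc : ∀ M y, l (f M * y) = l (y * f M))
    (hl : ∀ y, y ∈ LinearMap.range (CliffordAlgebra.ι Q) ↔
      CliffordAlgebra.involute y = -y ∧ CliffordAlgebra.reverse y = y ∧ l y = 0)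
    {M : Matrix (Fin 2) (Fin 2) (R ⊗[ℚ] H)} (hM : τ.adj R M * M = 1)
    {v : R ⊗[ℚ] CliffordAlgebra Q} (hv : v ∈ spinVectors Q R) :
    cliffordPointHom R f M * v * cliffordPointHom R f (τ.adj R M) ∈ spinVectors Q R := by
  rw [mem_spinVectors_iff R hl] at hv ⊢
  obtain ⟨h1, h2, h3⟩ := hv
  have hinv : ∀ M, Algebra.TensorProduct.map (AlgHom.id ℚ R) CliffordAlgebra.involute
      (cliffordPointHom R f M) = cliffordPointHom R f M := by
    intro M
    induction M using matrix_tensor_induction with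
    | zero => simp
    | add M N hM hN => rw [map_add, map_add, hM, hN]
    | single i j r h =>
      have : f (Matrix.single i j h) ∈ CliffordAlgebra.even Q := hr ▸ ⟨_, rfl⟩
      rw [cliffordPointHom_single, Algebra.TensorProduct.map_tmul,
        CliffordAlgebra.mem_even_iff_involute.1 this]
      rfl
  refine ⟨?_, ?_, ?_⟩
  · rw [map_mul, map_mul, hinv, hinv, h1, mul_neg, neg_mul]
  · rw [spinRev_mul, spinRev_mul, h2, spinRev_cliffordPointHom R f τ hrev,
      spinRev_cliffordPointHom R f τ hrev, τ.adj_adj, mul_assoc]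
  · rw [mul_assoc, lTensor_cliffordPointHom_mul_comm R f hc, mul_assoc, ← map_mul, hM, map_one,
      mul_one, h3]

theorem nonempty_iso_spinFunctor [Module.Finite ℚ H] {τ : AlgInvolution H}
    {l : CliffordAlgebra Q →ₗ[ℚ] ℚ} (hinj : Function.Injective f)
    (hr : f.range = CliffordAlgebra.even Q)
    (hrev : ∀ M, CliffordAlgebra.reverse (f M) = f (τ.adjLinear M))
    (hc : ∀ M y, l (f M * y) = l (y * f M))
    (hl : ∀ y, y ∈ LinearMap.range (CliffordAlgebra.ι Q) ↔
      CliffordAlgebra.involute y = -y ∧ CliffordAlgebra.reverse y = y ∧ l y = 0) :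
    Nonempty (τ.SL ≅ spinFunctor Q) := by
  have hleft : ∀ (R : Type) [CommRing R] [Algebra ℚ R] (M : τ.slMonoid R),
      τ.adj R M.1 * M.1 = 1 := fun R _ _ M => τ.adj_mul_self M.2
  have hright : ∀ (R : Type) [CommRing R] [Algebra ℚ R] (M : τ.slMonoid R),
      M.1 * τ.adj R M.1 = 1 := fun R _ _ M => (τ.isSL_iff R M.1).1 M.2
  let u : ∀ (R : Type) [CommRing R] [Algebra ℚ R], τ.slMonoid R →
      (R ⊗[ℚ] CliffordAlgebra Q)ˣ := fun R _ _ M =>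
    ⟨cliffordPointHom R f M.1, cliffordPointHom R f (τ.adj R M.1),
      by rw [← map_mul, hright, map_one], by rw [← map_mul, hleft, map_one]⟩
  have hu : ∀ (R : Type) [CommRing R] [Algebra ℚ R] (M : τ.slMonoid R),
      u R M ∈ spinPoints Q R := by
    intro R _ _ M
    refine ⟨(mem_spinEven_iff R f hr).2 ⟨M.1, rfl⟩, ?_, fun v => ⟨fun hv => ?_, fun hv => ?_⟩⟩
    · change cliffordPointHom R f M.1 * spinRev Q R (cliffordPointHom R f M.1) = 1
      rw [spinRev_cliffordPointHom R f τ hrev, ← map_mul, hright, map_one]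
    · exact cliffordPointHom_conj_mem_spinVectors R f hr hrev hc hl (hleft R M) hv
    -- The converse inclusion is the same statement for the inverse matrix `adj M`.
    · have h1 := cliffordPointHom_conj_mem_spinVectors R f hr hrev hc hl (M := τ.adj R M.1)
        (by rw [τ.adj_adj, hright]) hv
      rw [τ.adj_adj] at h1
      change (↑(u R M)⁻¹ : R ⊗[ℚ] CliffordAlgebra Q) * (u R M * v * ↑(u R M)⁻¹) * u R M ∈ _ at h1
      rwa [mul_assoc, mul_assoc, Units.inv_mul, mul_one, Units.inv_mul_cancel_left] at h1
  let φ : ∀ (R : Type) [CommRing R] [Algebra ℚ R], τ.slMonoid R →* spinPoints Q R :=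
    fun R _ _ =>
      { toFun := fun M => ⟨u R M, hu R M⟩
        map_one' := Subtype.ext (Units.ext (map_one (cliffordPointHom R f)))
        map_mul' := fun M N => Subtype.ext (Units.ext (map_mul (cliffordPointHom R f) M.1 N.1)) }
  have hφ : ∀ (R : Type) [CommRing R] [Algebra ℚ R], Function.Bijective (φ R) := by
    intro R _ _
    constructor
    · intro M N hMN
      exact Subtype.ext (cliffordPointHom_injective R f hinj
        (congrArg (fun x : spinPoints Q R => (x.1 : R ⊗[ℚ] CliffordAlgebra Q)) hMN))
    -- Only evenness and `x x̃ = 1` are used: they already produce a matrix with `M · adj M = 1`.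
    · rintro ⟨x, hx⟩
      obtain ⟨M, hM⟩ := (mem_spinEven_iff R f hr).1 hx.1
      have h1 := hx.2.1
      rw [← hM, spinRev_cliffordPointHom R f τ hrev, ← map_mul, ← map_one (cliffordPointHom R f)]
        at h1
      exact ⟨⟨M, (τ.isSL_iff R M).2 (cliffordPointHom_injective R f hinj h1)⟩,
        Subtype.ext (Units.ext hM)⟩
  exact ⟨NatIso.ofComponents (fun R => MulEquiv.toGrpIso (X := GrpCat.of (τ.slMonoid R))
    (Y := GrpCat.of (spinPoints Q R)) (MulEquiv.ofBijective (φ R) (hφ R)))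
    fun {R S} g => GrpCat.hom_ext (MonoidHom.ext fun M => Subtype.ext (Units.ext
      (map_cliffordPointHom f g.hom M.1).symm))⟩

end BaseChange

/-! ### Coordinate rings. -/

section Representability

/-- A functor to groups is an affine algebraic group if it has a universal point over a finitely
generated algebra. -/
theorem isAffineAlgebraicGroup_of_universal (G : CommAlgCat.{0} ℚ ⥤ GrpCat.{0})
    (A : CommAlgCat.{0} ℚ) [Algebra.FiniteType ℚ A] (x : G.obj A)
    (h : ∀ (R : CommAlgCat.{0} ℚ) (y : G.obj R), ∃! f : A ⟶ R, G.map f x = y) :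
    IsAffineAlgebraicGroup G :=
  ⟨A, inferInstance, ⟨{
    homEquiv := fun {R} => Equiv.ofBijective (fun f => G.map f x)
      (Function.bijective_iff_existsUnique _ |>.2 (h R))
    homEquiv_comp := fun g f => by simp }⟩⟩

theorem IsAffineAlgebraicGroup.of_iso {G G' : CommAlgCat.{0} ℚ ⥤ GrpCat.{0}}
    (h : IsAffineAlgebraicGroup G) (e : G ≅ G') : IsAffineAlgebraicGroup G' := by
  obtain ⟨A, hA, ⟨r⟩⟩ := h
  exact ⟨A, hA, ⟨r.ofIso (Functor.isoWhiskerRight e (forget GrpCat))⟩⟩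

variable {H : Type} [Ring H] [Algebra ℚ H]

theorem baseChange_repr_map {ι R S : Type} [CommRing R] [Algebra ℚ R] [CommRing S]
    [Algebra ℚ S] (B : Module.Basis ι ℚ H) (g : R →ₐ[ℚ] S) (x : R ⊗[ℚ] H) (i : ι) :
    (B.baseChange S).repr (Algebra.TensorProduct.map g (AlgHom.id ℚ H) x) i =
      g ((B.baseChange R).repr x i) := by
  induction x using TensorProduct.induction_on with
  | zero => simp
  | add x y hx hy => simp [hx, hy]
  | tmul r h => simp

theorem isSL_map_iff (τ : AlgInvolution H) {R S : Type} [CommRing R] [Algebra ℚ R] [CommRing S]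
    [Algebra ℚ S] (g : R →ₐ[ℚ] S) (M : Matrix (Fin 2) (Fin 2) (R ⊗[ℚ] H)) :
    τ.IsSL S (M.map (Algebra.TensorProduct.map g (AlgHom.id ℚ H))) ↔
      ∀ i j, Algebra.TensorProduct.map g (AlgHom.id ℚ H) ((M * τ.adj R M - 1) i j) = 0 := by
  set F := Algebra.TensorProduct.map g (AlgHom.id ℚ H) with hF
  have h : τ.adj S (M.map F) = (τ.adj R M).map F := by
    ext i j
    fin_cases i <;> fin_cases j <;> simp [AlgInvolution.adj, hF, τ.baseExt_map]
  have h2 : M.map F * τ.adj S (M.map F) - 1 = (M * τ.adj R M - 1).map F := by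
    rw [h, Matrix.map_sub _ (map_sub F), Matrix.map_mul, Matrix.map_one _ (map_zero F) (map_one F)]
  rw [τ.isSL_iff, ← sub_eq_zero, h2, ← Matrix.ext_iff]
  rfl

/-- In a basis of `H`, a matrix over `R ⊗ H` is a tuple in `R`, and `M · adj M = 1` becomes
polynomial equations in the tuple with coefficients independent of `R`. The generic matrix modulo
these equations is the universal point. -/
theorem isAffineAlgebraicGroup_SL [Module.Finite ℚ H] (τ : AlgInvolution H) : IsAffineAlgebraicGroup τ.SL := by
  let B := Module.finBasis ℚ H
  let n := Module.finrank ℚ H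
  let P := MvPolynomial (Fin 2 × Fin 2 × Fin n) ℚ
  -- the generic matrix
  let X : Matrix (Fin 2) (Fin 2) (P ⊗[ℚ] H) := fun i j =>
    ∑ k, MvPolynomial.X (R := ℚ) (i, j, k) ⊗ₜ B k
  have hX : ∀ {S : Type} [CommRing S] [Algebra ℚ S] (g : P →ₐ[ℚ] S) (i j k),
      (B.baseChange S).repr (Algebra.TensorProduct.map g (AlgHom.id ℚ H) (X i j)) k =
        g (MvPolynomial.X (i, j, k)) := by
    intro S _ _ g i j k
    simp [X, Finsupp.single_apply]
  let I : Ideal P := Ideal.span (Set.range fun t : Fin 2 × Fin 2 × Fin n =>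
    (B.baseChange P).repr ((X * τ.adj P X - 1) t.1 t.2.1) t.2.2)
  have hI : ∀ {S : Type} [CommRing S] [Algebra ℚ S] (g : P →ₐ[ℚ] S),
      τ.IsSL S (X.map (Algebra.TensorProduct.map g (AlgHom.id ℚ H))) ↔ ∀ p ∈ I, g p = 0 := by
    intro S _ _ g
    have h1 : (∀ p ∈ I, g p = 0) ↔ I ≤ RingHom.ker g := Iff.rfl
    rw [isSL_map_iff, h1, Ideal.span_le]
    constructor
    · rintro h _ ⟨⟨i, j, k⟩, rfl⟩
      change g _ = 0
      rw [← baseChange_repr_map, h, map_zero]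
      rfl
    · intro h i j
      apply (B.baseChange S).repr.injective
      ext k
      rw [baseChange_repr_map, map_zero]
      exact h ⟨(i, j, k), rfl⟩
  let A : CommAlgCat.{0} ℚ := CommAlgCat.of ℚ (P ⧸ I)
  let π : P →ₐ[ℚ] A := Ideal.Quotient.mkₐ ℚ I
  have hcomp : ∀ {R : CommAlgCat.{0} ℚ} (g : A →ₐ[ℚ] R),
      (X.map (Algebra.TensorProduct.map π (AlgHom.id ℚ H))).map
        (Algebra.TensorProduct.map g (AlgHom.id ℚ H)) =
      X.map (Algebra.TensorProduct.map (g.comp π) (AlgHom.id ℚ H)) := by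
    intro R g
    rw [Matrix.map_map, ← AlgHom.coe_comp, ← Algebra.TensorProduct.map_comp, AlgHom.comp_id]
  have hft : Algebra.FiniteType ℚ A :=
    Algebra.FiniteType.of_surjective π (Ideal.Quotient.mkₐ_surjective ℚ I)
  let x : τ.SL.obj A := ⟨X.map (Algebra.TensorProduct.map π (AlgHom.id ℚ H)),
    (hI π).2 fun p hp => Ideal.Quotient.eq_zero_iff_mem.2 hp⟩
  refine isAffineAlgebraicGroup_of_universal τ.SL A x fun R y => ?_
  obtain ⟨M, hM⟩ := y
  -- Each variable is sent to the corresponding coordinate of `M`, so the generic matrix specialises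
  -- to `M`.
  let g : P →ₐ[ℚ] R := MvPolynomial.aeval fun t => (B.baseChange R).repr (M t.1 t.2.1) t.2.2
  have hg : X.map (Algebra.TensorProduct.map g (AlgHom.id ℚ H)) = M := by
    ext i j
    apply (B.baseChange R).repr.injective
    ext k
    rw [Matrix.map_apply, hX]
    exact MvPolynomial.aeval_X _ _
  have hgI : ∀ p ∈ I, g p = 0 := (hI g).1 (by rw [hg]; exact hM)
  refine ⟨CommAlgCat.ofHom (Ideal.Quotient.liftₐ I g hgI), Subtype.ext ?_, fun f hf => ?_⟩
  · refine (hcomp (Ideal.Quotient.liftₐ I g hgI)).trans ?_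
    have h1 : (Ideal.Quotient.liftₐ I g hgI).comp π = g := AlgHom.ext fun _ => rfl
    rw [h1, hg]
  -- Uniqueness: a map taking the universal point to `M` has its values on the variables forced to
  -- be the coordinates of `M`.
  · apply CommAlgCat.hom_ext
    apply Ideal.Quotient.algHom_ext
    apply MvPolynomial.algHom_ext
    rintro ⟨i, j, k⟩
    have h1 : X.map (Algebra.TensorProduct.map (f.hom.comp π) (AlgHom.id ℚ H)) = M :=
      (hcomp f.hom).symm.trans (congrArg Subtype.val hf)
    have h2 := hX (f.hom.comp π) i j k
    rw [← Matrix.map_apply (M := X) (f := Algebra.TensorProduct.map (f.hom.comp π) (AlgHom.id ℚ H)),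
      h1] at h2
    refine h2.symm.trans ?_
    have h3 : g (MvPolynomial.X (i, j, k)) = (B.baseChange R).repr (M i j) k :=
      MvPolynomial.aeval_X _ _
    exact h3.symm

end Representability

end

theorem mainTheorem13 (a b : ℚ) (ha : a ≠ 0) (hb : b ≠ 0)
    (τ : AlgInvolution ℍ[ℚ,a,b]) (hτ : τ.IsOrthogonal) :
    IsAffineAlgebraicGroup τ.SL ∧
    IsAffineAlgebraicGroup (spinFunctor (inversiveForm τ)) ∧
    Nonempty (τ.SL ≅ spinFunctor (inversiveForm τ)) := by
  obtain ⟨f, l, hinj, hr, hrev, hc, hl⟩ := exists_even_splitting ha hb hτ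
  have hSL := isAffineAlgebraicGroup_SL τ
  have hiso := nonempty_iso_spinFunctor f hinj hr hrev hc hl
  exact ⟨hSL, hiso.elim fun e => hSL.of_iso e, hiso⟩
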